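/- Let $n\ge 1$ and let $s_i=(i,i+1)$, $1\le i\le n-1$, be the simple transpositions of the symmetric group $S_n$. For $w\in S_n$ let $\ell(w)$ be the smallest $\ell$ for which $w$ is a product of $\ell$ simple transpositions; a reduced word for $w$ is a sequence $(e_1,\dots,e_{\ell(w)})$ in $\{1,\dots,n-1\}$ with $w=s_{e_1}\cdots s_{e_{\ell(w)}}$. The double Schubert polynomials $\mathfrak S_w(X;Y)\in\mathbb Z[x_1,x_2,\dots,y_1,y_2,\dots]$ are defined recursively: for the longest element $w_0\in S_n$, $\mathfrak S_{w_0}(X;Y)=\prod_{i,j\ge 1,\ i+j\le n}(x_i-y_j)$, and for $w\ne w_0$, $\mathfrak S_w(X;Y)=\partial_i\bigl(\mathfrak S_{ws_i}(X;Y)\bigr)$ for any $i$ with $\ell(ws_i)=\ell(w)+1$, where $\partial_i(f)=\dfrac{f-f|_{x_i\leftrightarrow x_{i+1}}}{x_i-x_{i+1}}$ (the result does not depend on the choice of $i$). **Corollary.** Let $w\in S_n$ and let $x^uy^v=x_1^{u_1}\cdots x_{n-1}^{u_{n-1}}y_1^{v_1}\cdots y_{n-1}^{v_{n-1}}$ be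 a monomial of total degree $\ell(w)$. For $0\le i\le n-1$ set $g_i=\sum_{k=n-i}^{n-1}v_k$ and $f_i=g_{n-1}+\sum_{k=1}^{i}u_k$ (so $g_0=0$ and $f_0=g_{n-1}$). Then the coefficient of $x^uy^v$ in $\mathfrak S_w(X;Y)$ equals $(-1)^{g_{n-1}}$ times the number of reduced words $(e_1,\dots,e_{\ell(w)})$ for $w$ such that, for all $1\le i\le n-1$, $$n-i\le e_{g_{i-1}+1}<e_{g_{i-1}+2}<\dots<e_{g_i}\qquad\text{and}\qquad e_{f_{i-1}+1}>e_{f_{i-1}+2}>\dots>e_{f_i}\ge i .$$ Here a chain of inequalities imposes no condition when its block of indices is empty, that is, when $g_{i-1}=g_i$, respectively $f_{i-1}=f_i$. -/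

import Mathlib

namespace DoubleSchubert

/-! ### Reduced words in the symmetric group

The symmetric group on `n` letters is `Equiv.Perm (Fin n)`; the element `k : Fin n` stands for the
letter `k + 1`. Simple transpositions are indexed by `1 ≤ i ≤ n - 1`. -/

/-- The simple transposition `s_i = (i, i + 1)` for `1 ≤ i < n`, and the identity for other `i`.
Letter `i` of `{1, …, n}` is the element `i - 1` of `Fin n`. -/
def simple (n i : ℕ) : Equiv.Perm (Fin n) :=
  if h : 1 ≤ i ∧ i < n then Equiv.swap ⟨i - 1, by omega⟩ ⟨i, h.2⟩ else 1

/-- `e = (e_1, …, e_l)` is a word for `w`: all `e_k` lie in `{1, …, n - 1}` and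
`w = s_{e_1} s_{e_2} ⋯ s_{e_l}`. -/
def IsWord {n : ℕ} (w : Equiv.Perm (Fin n)) (e : List ℕ) : Prop :=
  (∀ a ∈ e, 1 ≤ a ∧ a < n) ∧ (e.map (simple n)).prod = w

/-- The length `ℓ(w)`: the smallest number of simple transpositions with product `w`. -/
noncomputable def len {n : ℕ} (w : Equiv.Perm (Fin n)) : ℕ :=
  sInf {k | ∃ e : List ℕ, IsWord w e ∧ e.length = k}

/-- A reduced word for `w`: a word for `w` with exactly `ℓ(w)` letters. -/
def IsReducedWord {n : ℕ} (w : Equiv.Perm (Fin n)) (e : List ℕ) : Prop :=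
  IsWord w e ∧ e.length = len w

/-- `s_i` is a simple transposition with `ℓ(w s_i) = ℓ(w) + 1`. -/
def IsAscent {n : ℕ} (w : Equiv.Perm (Fin n)) (i : ℕ) : Prop :=
  1 ≤ i ∧ i < n ∧ len (w * simple n i) = len w + 1

/-! ### Divided differences

Polynomials have integer coefficients and variables indexed by `ℕ ⊕ ℕ`: `x_i` is the variable
`Sum.inl i` and `y_j` is the variable `Sum.inr j` (only indices `≥ 1` occur). -/

/-- The polynomial ring `ℤ[x_1, x_2, …, y_1, y_2, …]`. -/
abbrev Poly : Type := MvPolynomial (ℕ ⊕ ℕ) ℤ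

/-- The variable `x_i`. -/
noncomputable def x (i : ℕ) : Poly := MvPolynomial.X (Sum.inl i)

/-- The variable `y_j`. -/
noncomputable def y (j : ℕ) : Poly := MvPolynomial.X (Sum.inr j)

/-- The exchange of the variables `x_i` and `x_{i+1}`. -/
noncomputable def exch (i : ℕ) : Poly →ₐ[ℤ] Poly :=
  MvPolynomial.rename (Equiv.swap (Sum.inl i) (Sum.inl (i + 1)))

theorem x_sub_dvd (i : ℕ) (f : Poly) : (x i - x (i + 1)) ∣ f - exch i f := by
  rw [← Ideal.mem_span_singleton, ← Ideal.Quotient.mk_eq_mk_iff_sub_mem]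
  set I : Ideal Poly := Ideal.span {x i - x (i + 1)} with hI
  have hx : Ideal.Quotient.mk I (x i) = Ideal.Quotient.mk I (x (i + 1)) := by
    rw [Ideal.Quotient.mk_eq_mk_iff_sub_mem]
    exact Ideal.subset_span rfl
  have key : (Ideal.Quotient.mkₐ ℤ I) = (Ideal.Quotient.mkₐ ℤ I).comp (exch i) := by
    apply MvPolynomial.algHom_ext
    intro j
    simp only [AlgHom.comp_apply, exch, MvPolynomial.rename_X, Ideal.Quotient.mkₐ_eq_mk]
    by_cases h1 : j = Sum.inl i
    · subst h1; rw [Equiv.swap_apply_left]; exact hx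
    by_cases h2 : j = Sum.inl (i + 1)
    · subst h2; rw [Equiv.swap_apply_right]; exact hx.symm
    rw [Equiv.swap_apply_of_ne_of_ne h1 h2]
  exact DFunLike.congr_fun key f

/-- The divided difference `∂_i f = (f - f(x_i ↔ x_{i+1})) / (x_i - x_{i+1})`. -/
noncomputable def divDiff (i : ℕ) (f : Poly) : Poly := (x_sub_dvd i f).choose

theorem divDiff_spec (i : ℕ) (f : Poly) :
    (x i - x (i + 1)) * divDiff i f = f - exch i f :=
  (x_sub_dvd i f).choose_spec.symm

/-! ### Double Schubert polynomials -/

/-- The polynomial `∏_{i + j ≤ n} (x_i - y_j)`, the product being over `i, j ≥ 1`. -/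
noncomputable def topPoly (n : ℕ) : Poly :=
  ∏ p ∈ (Finset.Icc 1 n ×ˢ Finset.Icc 1 n).filter (fun p => p.1 + p.2 ≤ n), (x p.1 - y p.2)

open Classical in
/-- The double Schubert polynomial of `w`. For the longest permutation `w_0` (the reversal) it is
`∏_{i + j ≤ n} (x_i - y_j)`; for another `w` it is `∂_i` of the double Schubert polynomial of
`w s_i`, where `s_i` is a simple transposition with `ℓ(w s_i) = ℓ(w) + 1`. The last branch never
occurs (`exists_isAscent`), and any such `s_i` gives the same result (`doubleSchubert_eq`). -/
noncomputable def doubleSchubert {n : ℕ} (w : Equiv.Perm (Fin n)) : Poly :=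
  if w = Fin.revPerm then topPoly n
  else if h : ∃ i, IsAscent w i then
    divDiff h.choose (doubleSchubert (w * simple n h.choose))
  else 0
termination_by (Finset.univ.sup (len (n := n))) - len w
decreasing_by
  have h1 := h.choose_spec.2.2
  have h2 : len (w * simple n h.choose) ≤ Finset.univ.sup (len (n := n)) :=
    Finset.le_sup (Finset.mem_univ _)
  omega

/-! #### The length counts inversions -/

theorem simple_eq {n i : ℕ} (h1 : 1 ≤ i) (h2 : i < n) :
    simple n i = Equiv.swap ⟨i - 1, by omega⟩ ⟨i, h2⟩ := by
  simp [simple, h1, h2]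

theorem simple_mul_self (n i : ℕ) : simple n i * simple n i = 1 := by
  unfold simple; split <;> simp

/-- The set of inversions of `w`. -/
def invSet {n : ℕ} (w : Equiv.Perm (Fin n)) : Finset (Fin n × Fin n) :=
  Finset.univ.filter (fun p => p.1 < p.2 ∧ w p.2 < w p.1)

theorem mem_invSet {n : ℕ} (w : Equiv.Perm (Fin n)) (a b : Fin n) :
    (a, b) ∈ invSet w ↔ a < b ∧ w b < w a := by
  simp [invSet]

theorem simple_lt {n i : ℕ} (h1 : 1 ≤ i) (h2 : i < n) {a b : Fin n} (hab : a < b)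
    (hne : ¬ (a.val = i - 1 ∧ b.val = i)) : simple n i a < simple n i b := by
  rw [simple_eq h1 h2, Equiv.swap_apply_def, Equiv.swap_apply_def]
  simp only [Fin.ext_iff, Fin.lt_def] at *
  split_ifs <;> (try simp only) <;> omega

theorem card_invSet_mul {n i : ℕ} (w : Equiv.Perm (Fin n)) (h1 : 1 ≤ i) (h2 : i < n)
    (hw : w ⟨i - 1, by omega⟩ < w ⟨i, h2⟩) :
    (invSet (w * simple n i)).card = (invSet w).card + 1 := by
  set s := simple n i with hs
  have hsl : s ⟨i - 1, by omega⟩ = ⟨i, h2⟩ := by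
    rw [hs, simple_eq h1 h2, Equiv.swap_apply_left]
  have hsr : s ⟨i, h2⟩ = ⟨i - 1, by omega⟩ := by
    rw [hs, simple_eq h1 h2, Equiv.swap_apply_right]
  have hss : ∀ a, s (s a) = a := fun a => by
    rw [← Equiv.Perm.mul_apply, hs, simple_mul_self]; rfl
  have key : invSet (w * s) =
      insert (⟨i - 1, by omega⟩, ⟨i, h2⟩)
        ((invSet w).map (s.prodCongr s).toEmbedding) := by
    ext ⟨a, b⟩
    simp only [mem_invSet, Finset.mem_insert, Finset.mem_map, Equiv.coe_toEmbedding, Prod.exists, Equiv.prodCongr_apply, Prod.map,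
      Prod.mk.injEq, Equiv.Perm.mul_apply]
    constructor
    · rintro ⟨hab, hlt⟩
      by_cases hc : a.val = i - 1 ∧ b.val = i
      · left; exact ⟨Fin.ext hc.1, Fin.ext hc.2⟩
      · right
        exact ⟨s a, s b, ⟨simple_lt h1 h2 hab hc, hlt⟩, hss a, hss b⟩
    · rintro (⟨rfl, rfl⟩ | ⟨c, d, ⟨hcd, hlt⟩, rfl, rfl⟩)
      · rw [hsl, hsr]
        exact ⟨by simp only [Fin.lt_def]; omega, hw⟩
      · rw [hss, hss]
        refine ⟨simple_lt h1 h2 hcd ?_, hlt⟩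
        rintro ⟨hc, hd⟩
        have e1 : c = ⟨i - 1, by omega⟩ := Fin.ext hc
        have e2 : d = ⟨i, h2⟩ := Fin.ext hd
        rw [e1, e2] at hlt
        exact absurd hlt (not_lt.2 hw.le)
  rw [key, Finset.card_insert_of_notMem, Finset.card_map]
  simp only [mem_invSet, Finset.mem_map, Equiv.coe_toEmbedding, Prod.exists, Equiv.prodCongr_apply, Prod.map, Prod.mk.injEq, not_exists,
    not_and, and_imp]
  intro c d hcd _ hc hd
  have e1 : c = ⟨i, h2⟩ := by rw [← hss c, hc, hsl]
  have e2 : d = ⟨i - 1, by omega⟩ := by rw [← hss d, hd, hsr]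
  rw [e1, e2] at hcd
  simp only [Fin.lt_def] at hcd
  omega

theorem card_invSet_mul_of_gt {n i : ℕ} (w : Equiv.Perm (Fin n)) (h1 : 1 ≤ i) (h2 : i < n)
    (hw : w ⟨i, h2⟩ < w ⟨i - 1, by omega⟩) :
    (invSet w).card = (invSet (w * simple n i)).card + 1 := by
  have := card_invSet_mul (w * simple n i) h1 h2 (by
    rw [Equiv.Perm.mul_apply, Equiv.Perm.mul_apply, simple_eq h1 h2, Equiv.swap_apply_left,
      Equiv.swap_apply_right]
    exact hw)
  rwa [mul_assoc, simple_mul_self, mul_one] at this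

theorem card_invSet_le {n : ℕ} (w : Equiv.Perm (Fin n)) {i : ℕ} (h1 : 1 ≤ i) (h2 : i < n) :
    (invSet (w * simple n i)).card ≤ (invSet w).card + 1 := by
  rcases lt_trichotomy (w ⟨i - 1, by omega⟩) (w ⟨i, h2⟩) with h | h | h
  · exact (card_invSet_mul w h1 h2 h).le
  · have := w.injective h
    simp only [Fin.mk.injEq] at this
    omega
  · have := card_invSet_mul_of_gt w h1 h2 h
    omega

theorem eq_one_of_no_descent {n : ℕ} (w : Equiv.Perm (Fin n))
    (h : ∀ i (h1 : 1 ≤ i) (h2 : i < n), w ⟨i - 1, by omega⟩ < w ⟨i, h2⟩) : w = 1 := by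
  cases n with
  | zero => exact Subsingleton.elim _ _
  | succ m =>
    have hm : StrictMono w := by
      rw [Fin.strictMono_iff_lt_succ]
      intro i
      exact h (i.val + 1) (by omega) (by omega)
    have := Subsingleton.elim (hm.orderIsoOfSurjective w w.surjective) (OrderIso.refl _)
    ext i
    have h2 := DFunLike.congr_fun this i
    simpa using congrArg Fin.val h2

theorem card_invSet_one (n : ℕ) : (invSet (1 : Equiv.Perm (Fin n))).card = 0 := by
  rw [Finset.card_eq_zero, invSet, Finset.filter_eq_empty_iff]
  rintro ⟨a, b⟩ _ ⟨h1, h2⟩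
  exact absurd h1 (not_lt.2 h2.le)

theorem card_invSet_le_length {n : ℕ} (e : List ℕ) (he : ∀ a ∈ e, 1 ≤ a ∧ a < n) :
    (invSet ((e.map (simple n)).prod)).card ≤ e.length := by
  induction e using List.reverseRecOn with
  | nil => simp [card_invSet_one]
  | append_singleton e a ih =>
    have ha := he a (by simp)
    have := ih (fun b hb => he b (by simp [hb]))
    simp only [List.map_append, List.map_cons, List.map_nil, List.prod_append, List.prod_cons,
      List.prod_nil, mul_one, List.length_append, List.length_cons, List.length_nil]
    have h3 := card_invSet_le (e.map (simple n)).prod ha.1 ha.2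
    omega

theorem exists_word {n : ℕ} (k : ℕ) (w : Equiv.Perm (Fin n)) (hk : (invSet w).card = k) :
    ∃ e, IsWord w e ∧ e.length = k := by
  induction k generalizing w with
  | zero =>
    have : w = 1 := by
      apply eq_one_of_no_descent
      intro i h1 h2
      by_contra hc
      have hne : w ⟨i, h2⟩ ≠ w ⟨i - 1, by omega⟩ := fun h => by
        have := w.injective h
        simp only [Fin.mk.injEq] at this
        omega
      have := card_invSet_mul_of_gt w h1 h2 (lt_of_le_of_ne (not_lt.1 hc) hne)
      omega
    exact ⟨[], ⟨by simp, by simp [this]⟩, rfl⟩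
  | succ k ih =>
    have : ∃ i, ∃ (h1 : 1 ≤ i) (h2 : i < n), w ⟨i, h2⟩ < w ⟨i - 1, by omega⟩ := by
      by_contra hc
      push Not at hc
      have h1 : w = 1 := by
        apply eq_one_of_no_descent
        intro i h1 h2
        refine lt_of_le_of_ne (hc i h1 h2) fun h => ?_
        have := w.injective h
        simp only [Fin.mk.injEq] at this
        omega
      rw [h1, card_invSet_one] at hk
      omega
    obtain ⟨i, h1, h2, hlt⟩ := this
    have hc := card_invSet_mul_of_gt w h1 h2 hlt
    obtain ⟨e, ⟨he1, he2⟩, he3⟩ := ih (w * simple n i) (by omega)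
    refine ⟨e ++ [i], ⟨?_, ?_⟩, by simp [he3]⟩
    · intro a ha
      rcases List.mem_append.1 ha with ha | ha
      · exact he1 a ha
      · rw [List.mem_singleton] at ha
        subst ha
        exact ⟨h1, h2⟩
    · simp [he2, mul_assoc, simple_mul_self]

theorem len_eq {n : ℕ} (w : Equiv.Perm (Fin n)) : len w = (invSet w).card := by
  obtain ⟨e, he, hl⟩ := exists_word _ w rfl
  apply le_antisymm
  · exact Nat.sInf_le ⟨e, he, hl⟩
  · refine le_csInf ⟨_, e, he, hl⟩ ?_
    rintro k ⟨e', ⟨h1, h2⟩, rfl⟩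
    have := card_invSet_le_length e' h1
    rwa [h2] at this

theorem isAscent_iff {n : ℕ} (w : Equiv.Perm (Fin n)) (i : ℕ) :
    IsAscent w i ↔ ∃ (_ : 1 ≤ i) (h2 : i < n), w ⟨i - 1, by omega⟩ < w ⟨i, h2⟩ := by
  constructor
  · rintro ⟨h1, h2, h3⟩
    refine ⟨h1, h2, ?_⟩
    by_contra hc
    have hne : w ⟨i, h2⟩ ≠ w ⟨i - 1, by omega⟩ := fun h => by
      have := w.injective h
      simp only [Fin.mk.injEq] at this
      omega
    have := card_invSet_mul_of_gt w h1 h2 (lt_of_le_of_ne (not_lt.1 hc) hne)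
    rw [len_eq, len_eq] at h3
    omega
  · rintro ⟨h1, h2, h3⟩
    exact ⟨h1, h2, by rw [len_eq, len_eq]; exact card_invSet_mul w h1 h2 h3⟩

theorem not_isAscent_rev {n : ℕ} (i : ℕ) : ¬ IsAscent (Fin.revPerm : Equiv.Perm (Fin n)) i := by
  rw [isAscent_iff]
  rintro ⟨h1, h2, h3⟩
  rw [Fin.revPerm_apply, Fin.revPerm_apply, Fin.rev_lt_rev, Fin.lt_def] at h3
  simp only at h3
  omega

theorem exists_isAscent {n : ℕ} (w : Equiv.Perm (Fin n)) (hw : w ≠ Fin.revPerm) :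
    ∃ i, IsAscent w i := by
  by_contra hc
  apply hw
  have h1 : Fin.revPerm * w = 1 := by
    apply eq_one_of_no_descent
    intro i h1 h2
    rw [Equiv.Perm.mul_apply, Equiv.Perm.mul_apply, Fin.revPerm_apply, Fin.revPerm_apply,
      Fin.rev_lt_rev]
    refine lt_of_le_of_ne (not_lt.1 fun h => hc ⟨i, (isAscent_iff w i).2 ⟨h1, h2, h⟩⟩) fun h => ?_
    have := w.injective h
    simp only [Fin.mk.injEq] at this
    omega
  have h2 : (Fin.revPerm : Equiv.Perm (Fin n)) * Fin.revPerm = 1 := by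
    ext a; simp
  calc w = (Fin.revPerm * Fin.revPerm) * w := by rw [h2, one_mul]
    _ = Fin.revPerm := by rw [mul_assoc, h1, mul_one]

/-! #### Independence of the choices -/

theorem x_sub_ne {i j : ℕ} (h : i ≠ j) : x i - x j ≠ 0 := by
  intro h0
  have := MvPolynomial.X_injective (R := ℤ) (sub_eq_zero.1 h0)
  exact h (Sum.inl.inj this)

theorem exch_x (i j : ℕ) : exch i (x j) = if j = i then x (i + 1) else if j = i + 1 then x i
    else x j := by
  unfold exch x
  rw [MvPolynomial.rename_X]
  split_ifs with h1 h2
  · subst h1; rw [Equiv.swap_apply_left]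
  · subst h2; rw [Equiv.swap_apply_right]
  · rw [Equiv.swap_apply_of_ne_of_ne] <;> simp [h1, h2]

theorem swap_inl (a b k : ℕ) : Equiv.swap (Sum.inl a : ℕ ⊕ ℕ) (Sum.inl b) (Sum.inl k) =
    Sum.inl (if k = a then b else if k = b then a else k) := by
  rw [Equiv.swap_apply_def]
  simp only [Sum.inl.injEq]
  split_ifs <;> rfl

theorem swap_inr (a b k : ℕ) : Equiv.swap (Sum.inl a : ℕ ⊕ ℕ) (Sum.inl b) (Sum.inr k) =
    Sum.inr k :=
  Equiv.swap_apply_of_ne_of_ne (by simp) (by simp)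

theorem exch_exch (i : ℕ) (f : Poly) : exch i (exch i f) = f := by
  unfold exch
  rw [MvPolynomial.rename_rename]
  have : (Equiv.swap (Sum.inl i : ℕ ⊕ ℕ) (Sum.inl (i + 1))) ∘
      (Equiv.swap (Sum.inl i : ℕ ⊕ ℕ) (Sum.inl (i + 1))) = id := by
    funext k
    simp
  rw [this, MvPolynomial.rename_id_apply]

theorem exch_comm {i j : ℕ} (h : i + 2 ≤ j) (f : Poly) :
    exch i (exch j f) = exch j (exch i f) := by
  unfold exch
  rw [MvPolynomial.rename_rename, MvPolynomial.rename_rename]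
  congr 2
  funext k
  rcases k with k | k
  · simp only [Function.comp, swap_inl]
    congr 1
    split_ifs <;> omega
  · simp only [Function.comp, swap_inr]

theorem exch_braid (i : ℕ) (f : Poly) :
    exch i (exch (i + 1) (exch i f)) = exch (i + 1) (exch i (exch (i + 1) f)) := by
  unfold exch
  simp only [MvPolynomial.rename_rename]
  congr 2
  funext k
  rcases k with k | k
  · simp only [Function.comp, swap_inl]
    congr 1
    split_ifs <;> omega
  · simp only [Function.comp, swap_inr]

theorem divDiff_comm {i j : ℕ} (h : i + 2 ≤ j) (f : Poly) :
    divDiff i (divDiff j f) = divDiff j (divDiff i f) := by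
  have a1 := divDiff_spec i (divDiff j f)
  have a2 := divDiff_spec j (divDiff i f)
  have a3 := divDiff_spec i f
  have a4 := divDiff_spec j f
  have a5 := congrArg (exch i) a4
  have a6 := congrArg (exch j) a3
  simp only [map_mul, map_sub, exch_x] at a5 a6
  rw [if_neg (by omega), if_neg (by omega), if_neg (by omega), if_neg (by omega)] at a5 a6
  rw [← exch_comm h] at a6
  apply mul_left_cancel₀ (x_sub_ne (show i ≠ i + 1 by omega))
  apply mul_left_cancel₀ (x_sub_ne (show j ≠ j + 1 by omega))
  linear_combination (x j - x (j + 1)) * a1 - (x i - x (i + 1)) * a2 + a4 - a5 - a3 + a6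

theorem divDiff_braid (i : ℕ) (f : Poly) :
    divDiff i (divDiff (i + 1) (divDiff i f)) =
      divDiff (i + 1) (divDiff i (divDiff (i + 1) f)) := by
  have l1 := divDiff_spec i f
  have l2 := divDiff_spec (i + 1) (divDiff i f)
  have l3 := divDiff_spec i (divDiff (i + 1) (divDiff i f))
  have r1 := divDiff_spec (i + 1) f
  have r2 := divDiff_spec i (divDiff (i + 1) f)
  have r3 := divDiff_spec (i + 1) (divDiff i (divDiff (i + 1) f))
  have l11 := congrArg (exch i) l1
  have r22 := congrArg (exch (i + 1)) r1
  have l12 := congrArg (exch (i + 1)) l1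
  have l21 := congrArg (exch i) l2
  have l121 := congrArg (exch i) l12
  have r12 := congrArg (exch i) r1
  have r21 := congrArg (exch (i + 1)) r2
  have r121 := congrArg (exch (i + 1)) r12
  have hb := exch_braid i f
  have e1 : exch i (x i) = x (i + 1) := by simp [exch_x]
  have e2 : exch i (x (i + 1)) = x i := by simp [exch_x]
  have e3 : exch i (x (i + 1 + 1)) = x (i + 1 + 1) := by
    rw [exch_x, if_neg (by omega), if_neg (by omega)]
  have e4 : exch (i + 1) (x i) = x i := by
    rw [exch_x, if_neg (by omega), if_neg (by omega)]
  have e5 : exch (i + 1) (x (i + 1)) = x (i + 1 + 1) := by simp [exch_x]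
  have e6 : exch (i + 1) (x (i + 1 + 1)) = x (i + 1) := by simp [exch_x]
  simp only [map_mul, map_sub, exch_exch, e1, e2, e3, e4, e5, e6] at l11 l12 l21 l121 r22 r12 r21 r121
  have hab := x_sub_ne (show i ≠ i + 1 by omega)
  have hac := x_sub_ne (show i ≠ i + 1 + 1 by omega)
  have hbc := x_sub_ne (show i + 1 ≠ i + 1 + 1 by omega)
  generalize x i = a at *
  generalize x (i + 1) = b at *
  generalize x (i + 1 + 1) = c at *
  have L : (a - b) * (b - c) * (a - c) * divDiff i (divDiff (i + 1) (divDiff i f)) =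
      f - exch i f - exch (i + 1) f + exch i (exch (i + 1) f) + exch (i + 1) (exch i f)
        - exch i (exch (i + 1) (exch i f)) := by
    apply mul_left_cancel₀ hab
    linear_combination (a - b) * (b - c) * (a - c) * l3 + (a - b) * (a - c) * l2 + (a - c) * l1
      - (a - b) * l12 - (a - b) * (b - c) * l21 + (b - c) * l11 + (a - b) * l121
  have R : (a - b) * (b - c) * (a - c) * divDiff (i + 1) (divDiff i (divDiff (i + 1) f)) =
      f - exch i f - exch (i + 1) f + exch i (exch (i + 1) f) + exch (i + 1) (exch i f)
        - exch i (exch (i + 1) (exch i f)) := by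
    apply mul_left_cancel₀ hbc
    linear_combination (a - b) * (b - c) * (a - c) * r3 + (b - c) * (a - c) * r2 + (a - c) * r1
      - (b - c) * r12 - (a - b) * (b - c) * r21 + (a - b) * r22 + (b - c) * r121 + (b - c) * hb
  exact mul_left_cancel₀ (mul_ne_zero (mul_ne_zero hab hbc) hac) (L.trans R.symm)

theorem isAscent_mul_far {n i j : ℕ} {w : Equiv.Perm (Fin n)} (h : i + 2 ≤ j ∨ j + 2 ≤ i)
    (hi : IsAscent w i) (hj : IsAscent w j) : IsAscent (w * simple n i) j := by
  rw [isAscent_iff] at hi hj ⊢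
  obtain ⟨i1, i2, _⟩ := hi
  obtain ⟨j1, j2, j3⟩ := hj
  refine ⟨j1, j2, ?_⟩
  rw [Equiv.Perm.mul_apply, Equiv.Perm.mul_apply, simple_eq i1 i2,
    Equiv.swap_apply_of_ne_of_ne, Equiv.swap_apply_of_ne_of_ne]
  · exact j3
  all_goals
    simp only [ne_eq, Fin.mk.injEq]
    omega

theorem simple_comm {n i j : ℕ} (hi1 : 1 ≤ i) (hi2 : i < n) (hj1 : 1 ≤ j) (hj2 : j < n)
    (h : i + 2 ≤ j) : simple n i * simple n j = simple n j * simple n i := by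
  rw [simple_eq hi1 hi2, simple_eq hj1 hj2]
  ext k
  simp only [Equiv.Perm.mul_apply, Equiv.swap_apply_def, Fin.ext_iff]
  split_ifs <;> simp only at * <;> omega

theorem simple_braid {n i : ℕ} (hi1 : 1 ≤ i) (hi2 : i + 1 < n) :
    simple n i * simple n (i + 1) * simple n i =
      simple n (i + 1) * simple n i * simple n (i + 1) := by
  have e2 : simple n (i + 1) = Equiv.swap ⟨i, by omega⟩ ⟨i + 1, hi2⟩ :=
    simple_eq (by omega) hi2
  rw [simple_eq hi1 (by omega), e2]
  have h1 : (⟨i - 1, by omega⟩ : Fin n) ≠ ⟨i, by omega⟩ := by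
    simp only [ne_eq, Fin.mk.injEq]; omega
  have h2 : (⟨i - 1, by omega⟩ : Fin n) ≠ ⟨i + 1, hi2⟩ := by
    simp only [ne_eq, Fin.mk.injEq]; omega
  have h3 : (⟨i, by omega⟩ : Fin n) ≠ ⟨i + 1, hi2⟩ := by
    simp only [ne_eq, Fin.mk.injEq]; omega
  have h4 := Equiv.swap_mul_swap_mul_swap h3.symm h2.symm
  rw [Equiv.swap_comm (⟨i, by omega⟩ : Fin n) ⟨i - 1, by omega⟩,
    Equiv.swap_comm (⟨i + 1, hi2⟩ : Fin n) ⟨i, by omega⟩] at h4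
  rw [Equiv.swap_mul_swap_mul_swap h1 h2, h4, Equiv.swap_comm]

/-- The three ascents that follow from two consecutive ones. -/
theorem isAscent_braid {n i : ℕ} {w : Equiv.Perm (Fin n)} (hi : IsAscent w i)
    (hj : IsAscent w (i + 1)) :
    (IsAscent (w * simple n i) (i + 1) ∧ IsAscent (w * simple n i * simple n (i + 1)) i) ∧
    (IsAscent (w * simple n (i + 1)) i ∧
      IsAscent (w * simple n (i + 1) * simple n i) (i + 1)) := by
  rw [isAscent_iff] at hi hj
  obtain ⟨i1, i2, i3⟩ := hi
  obtain ⟨j1, j2, j3⟩ := hj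
  simp only [Nat.add_sub_cancel] at j3
  have a1 : simple n i ⟨i - 1, by omega⟩ = ⟨i, i2⟩ := by
    rw [simple_eq i1 i2, Equiv.swap_apply_left]
  have a2 : simple n i ⟨i, i2⟩ = ⟨i - 1, by omega⟩ := by
    rw [simple_eq i1 i2, Equiv.swap_apply_right]
  have a3 : simple n i ⟨i + 1, j2⟩ = ⟨i + 1, j2⟩ := by
    rw [simple_eq i1 i2, Equiv.swap_apply_of_ne_of_ne] <;> simp only [ne_eq, Fin.mk.injEq] <;> omega
  have b1 : simple n (i + 1) ⟨i, i2⟩ = ⟨i + 1, j2⟩ := by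
    rw [simple_eq j1 j2]; exact Equiv.swap_apply_left _ _
  have b2 : simple n (i + 1) ⟨i + 1, j2⟩ = ⟨i, i2⟩ := by
    rw [simple_eq j1 j2]; exact Equiv.swap_apply_right _ _
  have b3 : simple n (i + 1) ⟨i - 1, by omega⟩ = ⟨i - 1, by omega⟩ := by
    rw [simple_eq j1 j2, Equiv.swap_apply_of_ne_of_ne] <;> simp only [ne_eq, Fin.mk.injEq] <;> omega
  simp only [isAscent_iff, Nat.add_sub_cancel, Equiv.Perm.mul_apply, a1, a2, a3, b1, b2, b3]
  exact ⟨⟨⟨j1, j2, i3.trans j3⟩, ⟨i1, i2, j3⟩⟩, ⟨⟨i1, i2, i3.trans j3⟩, ⟨j1, j2, i3⟩⟩⟩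

theorem doubleSchubert_rev (n : ℕ) :
    doubleSchubert (Fin.revPerm : Equiv.Perm (Fin n)) = topPoly n := by
  rw [doubleSchubert, if_pos rfl]

/-- The recursion holds for every choice of the simple transposition. -/
theorem doubleSchubert_eq {n : ℕ} (w : Equiv.Perm (Fin n)) (i : ℕ) (hi : IsAscent w i) :
    doubleSchubert w = divDiff i (doubleSchubert (w * simple n i)) := by
  have bound : ∀ v : Equiv.Perm (Fin n), len v ≤ Finset.univ.sup (len (n := n)) := fun v =>
    Finset.le_sup (Finset.mem_univ _)
  induction hd : Finset.univ.sup (len (n := n)) - len w using Nat.strong_induction_on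
    generalizing w i with
  | _ d ih =>
    have step : ∀ v : Equiv.Perm (Fin n), len w < len v → ∀ k, IsAscent v k →
        doubleSchubert v = divDiff k (doubleSchubert (v * simple n k)) := by
      intro v hv k hk
      have := bound v
      exact ih _ (by omega) v k hk rfl
    have far : ∀ i j, IsAscent w i → IsAscent w j → i + 2 ≤ j →
        divDiff i (doubleSchubert (w * simple n i)) =
          divDiff j (doubleSchubert (w * simple n j)) := by
      intro i j hi hj h
      rw [step _ (by have := hi.2.2; omega) j (isAscent_mul_far (Or.inl h) hi hj),
        step _ (by have := hj.2.2; omega) i (isAscent_mul_far (Or.inr h) hj hi),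
        divDiff_comm h, mul_assoc, mul_assoc,
        simple_comm hi.1 hi.2.1 hj.1 hj.2.1 h]
    have near : ∀ i, IsAscent w i → IsAscent w (i + 1) →
        divDiff i (doubleSchubert (w * simple n i)) =
          divDiff (i + 1) (doubleSchubert (w * simple n (i + 1))) := by
      intro i hi hj
      obtain ⟨⟨a1, a2⟩, b1, b2⟩ := isAscent_braid hi hj
      have hi3 := hi.2.2
      have hj3 := hj.2.2
      have a13 := a1.2.2
      have b13 := b1.2.2
      rw [step _ (by omega) _ a1, step _ (by omega) _ a2, step _ (by omega) _ b1,
        step _ (by omega) _ b2, divDiff_braid]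
      have := simple_braid (n := n) hi.1 hj.2.1
      simp only [mul_assoc] at this ⊢
      rw [this]
    have all : ∀ i j, IsAscent w i → IsAscent w j → i ≤ j →
        divDiff i (doubleSchubert (w * simple n i)) =
          divDiff j (doubleSchubert (w * simple n j)) := by
      intro i j hi hj h
      rcases h.eq_or_lt with rfl | h
      · rfl
      rcases (Nat.succ_le_of_lt h).eq_or_lt with h | h
      · subst h; exact near i hi hj
      · exact far i j hi hj h
    have hw : w ≠ Fin.revPerm := by
      rintro rfl
      exact not_isAscent_rev i hi
    have hex : ∃ i, IsAscent w i := ⟨i, hi⟩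
    rw [doubleSchubert, if_neg hw, dif_pos hex]
    rcases le_total hex.choose i with h | h
    · exact all _ _ hex.choose_spec hi h
    · exact (all _ _ hi hex.choose_spec h).symm

/-! ### The block conditions -/

/-- `g_i = v_{n-i} + ⋯ + v_{n-1}`, with `g_0 = 0`. -/
def gSum (n : ℕ) (v : ℕ → ℕ) (i : ℕ) : ℕ := ∑ k ∈ Finset.Ico (n - i) n, v k

/-- `f_i = g_{n-1} + u_1 + ⋯ + u_i`, with `f_0 = g_{n-1}`. -/
def fSum (n : ℕ) (u v : ℕ → ℕ) (i : ℕ) : ℕ := gSum n v (n - 1) + ∑ k ∈ Finset.Icc 1 i, u k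

/-- The letter `e_k` of `e = (e_1, …, e_l)`, for `1 ≤ k ≤ l`. -/
def letter (e : List ℕ) (k : ℕ) : ℕ := e.getD (k - 1) 0

/-- `m ≤ e_{a+1} < e_{a+2} < ⋯ < e_b`; no condition if the block `a + 1, …, b` is empty. -/
def IncBlock (e : List ℕ) (m a b : ℕ) : Prop :=
  (a < b → m ≤ letter e (a + 1)) ∧ ∀ k, a < k → k < b → letter e k < letter e (k + 1)

/-- `e_{a+1} > e_{a+2} > ⋯ > e_b ≥ m`; no condition if the block `a + 1, …, b` is empty. -/
def DecBlock (e : List ℕ) (m a b : ℕ) : Prop :=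
  (∀ k, a < k → k < b → letter e (k + 1) < letter e k) ∧ (a < b → m ≤ letter e b)

/-- The exponent vector of the monomial
`x_1^{u_1} ⋯ x_{n-1}^{u_{n-1}} y_1^{v_1} ⋯ y_{n-1}^{v_{n-1}}`. -/
noncomputable def expVec (n : ℕ) (u v : ℕ → ℕ) : (ℕ ⊕ ℕ) →₀ ℕ :=
  ∑ k ∈ Finset.Ico 1 n, (Finsupp.single (Sum.inl k) (u k) + Finsupp.single (Sum.inr k) (v k))

end DoubleSchubert

/-! Following Fomin and Kirillov, let `u_1, …, u_{n-1}` be the generators of the nilCoxeter algebra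
of `S_n` and `h_i(t) = 1 + t u_i`. Then `𝔖_w` is the coefficient of `w` in the product

  `∏_{j = n-1, …, 1} h_j(-y_j) ⋯ h_{n-1}(-y_j) * ∏_{i = 1, …, n-1} h_{n-1}(x_i) ⋯ h_i(x_i)`.

By the Yang–Baxter equation for the `h_i`, this product equals a product of `ℓ(w₀)` factors
`h_{i+j-1}(x_i - y_j)`, in which only the top-degree term reaches `w₀`; this gives `𝔖_{w₀}`.
Exchanging `x_i` and `x_{i+1}` in the product `P` subtracts `(x_i - x_{i+1}) P u_i` from it, so that
`∂_i P = P u_i`; this gives the descending recursion. In the product each variable occupies one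
block of factors, and its exponent in a monomial is the number of letters taken from that block.
The letters of a block are monotone, so a choice of that many of them is a monotone word, and the
coefficient is, up to sign, the number of reduced words of this shape. -/

namespace DoubleSchubert

/-! ### The nilCoxeter relations -/

section Products

variable {R A α : Type*} [CommRing R] [Ring A] [Algebra R A]

/-- The factor `h_i(t) = 1 + t u_i` attached to a generator `u_i`. -/
def hElem (u : α → A) (t : R) (i : α) : A := 1 + t • u i

/-- The product of the factors `h_i(t)` over a list of letters `i`, with one common parameter. -/
def hProd (u : α → A) (t : R) (L : List α) : A := (L.map (hElem u t)).prod

/-- The product of the factors `h_i(t)` over a list of pairs `(i, t)`. -/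
def factorProd (u : α → A) (L : List (α × R)) : A := (L.map fun p => hElem u p.2 p.1).prod

theorem hProd_nil (u : α → A) (t : R) : hProd u t [] = 1 := rfl

theorem hProd_cons (u : α → A) (t : R) (i : α) (L : List α) :
    hProd u t (i :: L) = hElem u t i * hProd u t L := rfl

theorem factorProd_cons (u : α → A) (p : α × R) (L : List (α × R)) :
    factorProd u (p :: L) = hElem u p.2 p.1 * factorProd u L := rfl

theorem factorProd_append (u : α → A) (L L' : List (α × R)) :
    factorProd u (L ++ L') = factorProd u L * factorProd u L' := by
  simp [factorProd]

theorem commute_hElem {a : A} {u : α → A} {i : α} (h : Commute a (u i)) (t : R) :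
    Commute a (hElem u t i) :=
  (Commute.one_right a).add_right (h.smul_right t)

theorem commute_hProd {a : A} {u : α → A} {L : List α} (h : ∀ i ∈ L, Commute a (u i)) (t : R) :
    Commute a (hProd u t L) := by
  refine Commute.list_prod_right _ _ fun b hb => ?_
  obtain ⟨i, hi, rfl⟩ := List.mem_map.1 hb
  exact commute_hElem (h i hi) t

/-- The product `h_{k+m-1}(t) ⋯ h_{k+1}(t) h_k(t)`. -/
def decProd (u : ℕ → A) (t : R) (m k : ℕ) : A := hProd u t (List.range' k m).reverse

/-- The product `h_k(t) h_{k+1}(t) ⋯ h_{k+m-1}(t)`. -/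
def incProd (u : ℕ → A) (t : R) (m k : ℕ) : A := hProd u t (List.range' k m)

theorem decProd_zero (u : ℕ → A) (t : R) (k : ℕ) : decProd u t 0 k = 1 := rfl

theorem incProd_zero (u : ℕ → A) (t : R) (k : ℕ) : incProd u t 0 k = 1 := rfl

theorem decProd_succ (u : ℕ → A) (t : R) (m k : ℕ) :
    decProd u t (m + 1) k = decProd u t m (k + 1) * hElem u t k := by
  simp [decProd, hProd, List.range'_succ]

theorem incProd_succ (u : ℕ → A) (t : R) (m k : ℕ) :
    incProd u t (m + 1) k = hElem u t k * incProd u t m (k + 1) := by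
  simp [incProd, hProd, List.range'_succ]

/-- The product `D_k(X_k) D_{k+1}(X_{k+1}) ⋯ D_{k+m-1}(X_{k+m-1})`, where
`D_i(t) = h_{k+m-1}(t) ⋯ h_i(t)`. -/
def xProd (u : ℕ → A) (X : ℕ → R) : ℕ → ℕ → A
  | 0, _ => 1
  | m + 1, k => decProd u (X k) (m + 1) k * xProd u X m (k + 1)

/-- The product `I_{m-1}(-Y_{j+m-1}) ⋯ I_1(-Y_{j+1}) I_0(-Y_j)`, where
`I_r(t) = h_{k+r}(t) ⋯ h_{k+m-1}(t)`. The letters and the parameters are shifted independently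
because the recursion for `yProd_mul_decProd` raises `k` but not `j`. -/
def yProd (u : ℕ → A) (Y : ℕ → R) : ℕ → ℕ → ℕ → A
  | 0, _, _ => 1
  | m + 1, k, j => yProd u Y m (k + 1) (j + 1) * incProd u (-Y j) (m + 1) k

/-- The letters and parameters of the product `h_{k+m-1}(t - Y_{j+m-1}) ⋯ h_k(t - Y_j)`. -/
def rowFactors (t : R) (Y : ℕ → R) : ℕ → ℕ → ℕ → List (ℕ × R)
  | 0, _, _ => []
  | m + 1, k, j => rowFactors t Y m (k + 1) (j + 1) ++ [(k, t - Y j)]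

/-- The rows `rowFactors (X i) Y (k + m - i) i j` for `i = k, …, k + m - 1`, one after the other. -/
def staircase (X Y : ℕ → R) (j : ℕ) : ℕ → ℕ → List (ℕ × R)
  | 0, _ => []
  | m + 1, k => rowFactors (X k) Y (m + 1) k j ++ staircase X Y j m (k + 1)

theorem xProd_eq_decProd_mul (u : ℕ → A) (X : ℕ → R) (m k : ℕ) :
    xProd u X m k = decProd u (X k) m k * xProd u X (m - 1) (k + 1) := by
  cases m <;> simp [xProd, decProd_zero]

theorem yProd_eq_mul_incProd (u : ℕ → A) (Y : ℕ → R) (m k j : ℕ) :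
    yProd u Y m k j = yProd u Y (m - 1) (k + 1) (j + 1) * incProd u (-Y j) m k := by
  cases m <;> simp [yProd, incProd_zero]

theorem xProd_congr (u : ℕ → A) {X X' : ℕ → R} {m k : ℕ} (h : ∀ i, k ≤ i → X i = X' i) :
    xProd u X m k = xProd u X' m k := by
  induction m generalizing k with
  | zero => rfl
  | succ m ih => rw [xProd, xProd, h k le_rfl, ih fun i hi => h i (by omega)]

theorem commute_xProd {a : A} {u : ℕ → A} {k : ℕ} (h : ∀ i, k ≤ i → Commute a (u i))
    (X : ℕ → R) (m : ℕ) : Commute a (xProd u X m k) := by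
  induction m generalizing k with
  | zero => exact Commute.one_right a
  | succ m ih =>
    exact (commute_hProd (fun i hi => h i (List.left_le_of_mem_range' (List.mem_reverse.1 hi)))
      _).mul_right (ih fun i hi => h i (by omega))

theorem commute_yProd {a : A} {u : ℕ → A} {k : ℕ} (h : ∀ i, k ≤ i → Commute a (u i))
    (Y : ℕ → R) (m j : ℕ) : Commute a (yProd u Y m k j) := by
  induction m generalizing k j with
  | zero => exact Commute.one_right a
  | succ m ih =>
    exact (ih (fun i hi => h i (by omega)) _).mul_right
      (commute_hProd (fun i hi => h i (List.left_le_of_mem_range' hi)) _)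

section Map

variable {S B : Type*} [CommRing S] [Ring B] [Algebra S B] {Φ : A →+* B} {φ : R →+* S}
  {u : ℕ → A} {u' : ℕ → B}

theorem map_hProd {u : α → A} {u' : α → B} (h : ∀ t i, Φ (t • u i) = φ t • u' i) (t : R)
    (L : List α) :
    Φ (hProd u t L) = hProd u' (φ t) L := by
  have hfactor : ∀ i, Φ (hElem u t i) = hElem u' (φ t) i := fun i => by simp [hElem, h]
  simp [hProd, map_list_prod, Function.comp_def, hfactor]

theorem map_xProd (h : ∀ t i, Φ (t • u i) = φ t • u' i) (X : ℕ → R) (m k : ℕ) :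
    Φ (xProd u X m k) = xProd u' (φ ∘ X) m k := by
  induction m generalizing k with
  | zero => exact map_one Φ
  | succ m ih => simp only [xProd, decProd, map_mul, map_hProd h, ih, Function.comp_apply]

theorem map_yProd (h : ∀ t i, Φ (t • u i) = φ t • u' i) (Y : ℕ → R) (m k j : ℕ) :
    Φ (yProd u Y m k j) = yProd u' (φ ∘ Y) m k j := by
  induction m generalizing k j with
  | zero => exact map_one Φ
  | succ m ih => simp only [yProd, incProd, map_mul, map_hProd h, ih, Function.comp_apply, map_neg]

end Map

end Products

/-- The defining relations of the nilCoxeter algebra of type `A`. -/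
structure IsNilCoxeter {A : Type*} [Ring A] (u : ℕ → A) : Prop where
  sq : ∀ i, u i * u i = 0
  comm : ∀ i j, i + 2 ≤ j → Commute (u i) (u j)
  braid : ∀ i, u i * u (i + 1) * u i = u (i + 1) * u i * u (i + 1)

namespace IsNilCoxeter

variable {R A : Type*} [CommRing R] [Ring A] [Algebra R A] {u : ℕ → A}

theorem hElem_mul_hElem (hu : IsNilCoxeter u) (s t : R) (i : ℕ) :
    hElem u s i * hElem u t i = hElem u (s + t) i := by
  simp only [hElem, mul_add, add_mul, mul_one, one_mul, smul_mul_smul_comm, hu.sq, smul_zero,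
    add_zero, add_smul, add_assoc]

theorem hElem_mul_hElem_neg (hu : IsNilCoxeter u) (t : R) (i : ℕ) :
    hElem u t i * hElem u (-t) i = 1 := by
  rw [hu.hElem_mul_hElem, add_neg_cancel, hElem, zero_smul, add_zero]

theorem hElem_neg_mul_hElem (hu : IsNilCoxeter u) (t : R) (i : ℕ) :
    hElem u (-t) i * hElem u t i = 1 := by
  rw [hu.hElem_mul_hElem, neg_add_cancel, hElem, zero_smul, add_zero]

theorem hElem_mul_gen (hu : IsNilCoxeter u) (t : R) (i : ℕ) : hElem u t i * u i = u i := by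
  rw [hElem, add_mul, one_mul, smul_mul_assoc, hu.sq, smul_zero, add_zero]

theorem yang_baxter (hu : IsNilCoxeter u) (s t : R) (i : ℕ) :
    hElem u s i * hElem u (s + t) (i + 1) * hElem u t i =
      hElem u t (i + 1) * hElem u (s + t) i * hElem u s (i + 1) := by
  simp only [hElem, mul_add, add_mul, mul_one, one_mul, smul_mul_assoc, mul_smul_comm,
    hu.sq, hu.braid, smul_zero]
  module

theorem commute_hElem_decProd (hu : IsNilCoxeter u) (s t : R) (m : ℕ) {i k : ℕ} (h : i + 2 ≤ k) :
    Commute (hElem u s i) (decProd u t m k) := by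
  refine commute_hProd (fun j hj => (commute_hElem (hu.comm i j ?_).symm s).symm) t
  have := List.left_le_of_mem_range' (List.mem_reverse.1 hj)
  omega

theorem commute_hElem_yProd (hu : IsNilCoxeter u) (s : R) (Y : ℕ → R) (m j : ℕ) {i k : ℕ}
    (h : i + 2 ≤ k) : Commute (hElem u s i) (yProd u Y m k j) :=
  commute_yProd (fun l hl => (commute_hElem (hu.comm i l (by omega)).symm s).symm) Y m j

theorem decProd_mul_incProd_neg (hu : IsNilCoxeter u) (t : R) (m k : ℕ) :
    decProd u t m k * incProd u (-t) m k = 1 := by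
  induction m generalizing k with
  | zero => exact one_mul 1
  | succ m ih =>
    rw [decProd_succ, incProd_succ, mul_assoc, ← mul_assoc (hElem u t k), hu.hElem_mul_hElem_neg,
      one_mul, ih]

theorem incProd_neg_mul_decProd (hu : IsNilCoxeter u) (t : R) (m k : ℕ) :
    incProd u (-t) m k * decProd u t m k = 1 := by
  induction m generalizing k with
  | zero => exact one_mul 1
  | succ m ih =>
    rw [decProd_succ, incProd_succ, mul_assoc, ← mul_assoc (incProd u _ _ _), ih, one_mul,
      hu.hElem_neg_mul_hElem]

theorem hElem_four_symm (hu : IsNilCoxeter u) (s t : R) (i : ℕ) :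
    hElem u (-t) (i + 1) * (hElem u s i * hElem u t (i + 1) * hElem u t i) =
      hElem u (-s) (i + 1) * (hElem u t i * hElem u s (i + 1) * hElem u s i) := by
  have hybe : hElem u s i * hElem u t (i + 1) * hElem u (t - s) i =
      hElem u (t - s) (i + 1) * hElem u t i * hElem u s (i + 1) := by
    simpa only [add_sub_cancel] using hu.yang_baxter s (t - s) i
  calc hElem u (-t) (i + 1) * (hElem u s i * hElem u t (i + 1) * hElem u t i)
    _ = hElem u (-t) (i + 1) *
          (hElem u s i * hElem u t (i + 1) * hElem u (t - s) i * hElem u s i) := by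
      rw [mul_assoc _ (hElem u (t - s) i), hu.hElem_mul_hElem, sub_add_cancel]
    _ = hElem u (-t) (i + 1) * hElem u (t - s) (i + 1) *
          (hElem u t i * hElem u s (i + 1) * hElem u s i) := by
      rw [hybe]; simp only [mul_assoc]
    _ = hElem u (-s) (i + 1) * (hElem u t i * hElem u s (i + 1) * hElem u s i) := by
      rw [hu.hElem_mul_hElem, neg_add_eq_sub, sub_sub_cancel_left]

theorem decProd_mul_decProd (hu : IsNilCoxeter u) (s t : R) (m k : ℕ) :
    decProd u s (m + 2) k * decProd u t (m + 2) k =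
      decProd u s (m + 1) (k + 1) * decProd u t (m + 1) (k + 1) *
        (hElem u (-t) (k + 1) * (hElem u s k * hElem u t (k + 1) * hElem u t k)) := by
  have hpeel : decProd u t (m + 1) (k + 1) * hElem u (-t) (k + 1) = decProd u t m (k + 2) := by
    rw [decProd_succ, mul_assoc, hu.hElem_mul_hElem_neg, mul_one]
  have hcomm : hElem u s k * decProd u t m (k + 2) = decProd u t m (k + 2) * hElem u s k :=
    hu.commute_hElem_decProd s t m le_rfl
  calc decProd u s (m + 2) k * decProd u t (m + 2) k
    _ = decProd u s (m + 1) (k + 1) * (hElem u s k * decProd u t m (k + 2)) *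
          (hElem u t (k + 1) * hElem u t k) := by
      simp only [decProd_succ u _ (m + 1) k, decProd_succ u t m (k + 1), mul_assoc]
    _ = decProd u s (m + 1) (k + 1) * (decProd u t (m + 1) (k + 1) * hElem u (-t) (k + 1)) *
          (hElem u s k * hElem u t (k + 1) * hElem u t k) := by
      rw [hcomm, hpeel]; simp only [mul_assoc]
    _ = _ := by simp only [mul_assoc]

theorem decProd_commute (hu : IsNilCoxeter u) (s t : R) (m k : ℕ) :
    Commute (decProd u s m k) (decProd u t m k) := by
  induction m using Nat.twoStepInduction generalizing k with
  | zero => exact Commute.one_left _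
  | one =>
    simp only [Commute, SemiconjBy, decProd_succ, decProd_zero, one_mul, hu.hElem_mul_hElem,
      add_comm]
  | more m _ ih =>
    rw [Commute, SemiconjBy, hu.decProd_mul_decProd, hu.decProd_mul_decProd, (ih (k + 1)).eq,
      hu.hElem_four_symm]

theorem incProd_mul_decProd_succ (hu : IsNilCoxeter u) (s t : R) (m k : ℕ) :
    incProd u (-t) (m + 1) k * decProd u s (m + 1) k =
      decProd u s m (k + 1) * hElem u (s - t) k * incProd u (-t) m (k + 1) := by
  calc incProd u (-t) (m + 1) k * decProd u s (m + 1) k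
    _ = incProd u (-t) (m + 1) k * (decProd u s (m + 1) k * decProd u t (m + 1) k) *
          incProd u (-t) (m + 1) k := by
      rw [mul_assoc, mul_assoc (decProd u s _ _), hu.decProd_mul_incProd_neg, mul_one]
    _ = decProd u s (m + 1) k * incProd u (-t) (m + 1) k := by
      rw [(hu.decProd_commute s t (m + 1) k).eq, ← mul_assoc, hu.incProd_neg_mul_decProd, one_mul]
    _ = _ := by
      rw [decProd_succ, incProd_succ, sub_eq_add_neg, ← hu.hElem_mul_hElem]
      simp only [mul_assoc]

theorem yProd_mul_decProd (hu : IsNilCoxeter u) (Y : ℕ → R) (t : R) (m k j : ℕ) :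
    yProd u Y m k j * decProd u t m k =
      factorProd u (rowFactors t Y m k j) * yProd u Y (m - 1) (k + 1) j := by
  induction m generalizing k j with
  | zero => rfl
  | succ m ih =>
    have hcomm : yProd u Y (m - 1) (k + 2) (j + 1) * hElem u (t - Y j) k =
        hElem u (t - Y j) k * yProd u Y (m - 1) (k + 2) (j + 1) :=
      (hu.commute_hElem_yProd _ Y _ _ le_rfl).eq.symm
    calc yProd u Y (m + 1) k j * decProd u t (m + 1) k
      _ = yProd u Y m (k + 1) (j + 1) * decProd u t m (k + 1) *
            (hElem u (t - Y j) k * incProd u (-Y j) m (k + 1)) := by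
        rw [yProd, mul_assoc, hu.incProd_mul_decProd_succ]; simp only [mul_assoc]
      _ = factorProd u (rowFactors t Y m (k + 1) (j + 1)) * (yProd u Y (m - 1) (k + 2) (j + 1) *
            hElem u (t - Y j) k) * incProd u (-Y j) m (k + 1) := by
        rw [ih]; simp only [mul_assoc]
      _ = factorProd u (rowFactors t Y m (k + 1) (j + 1)) * hElem u (t - Y j) k *
            yProd u Y m (k + 1) j := by
        rw [hcomm, yProd_eq_mul_incProd u Y m]; simp only [mul_assoc]
      _ = _ := by
        rw [rowFactors, factorProd_append, Nat.add_sub_cancel]; simp [factorProd]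

theorem yProd_mul_xProd (hu : IsNilCoxeter u) (X Y : ℕ → R) (m k j : ℕ) :
    yProd u Y m k j * xProd u X m k = factorProd u (staircase X Y j m k) := by
  induction m generalizing k with
  | zero => exact one_mul 1
  | succ m ih =>
    rw [xProd, ← mul_assoc, hu.yProd_mul_decProd, mul_assoc, Nat.add_sub_cancel, ih, staircase,
      factorProd_append]

theorem decProd_mul_decProd_sub (hu : IsNilCoxeter u) (s t : R) (m k : ℕ) :
    decProd u s (m + 1) k * decProd u t m (k + 1) - decProd u t (m + 1) k * decProd u s m (k + 1) =
      (s - t) • (decProd u s (m + 1) k * decProd u t m (k + 1) * u k) := by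
  have hpeel : ∀ s : R, decProd u s m (k + 1) = decProd u s (m + 1) k * hElem u (-s) k :=
    fun s => by rw [decProd_succ, mul_assoc, hu.hElem_mul_hElem_neg, mul_one]
  have hdiff : hElem u (-t) k - hElem u (-s) k = (s - t) • u k := by
    simp only [hElem]; module
  rw [hpeel t, hpeel s, ← mul_assoc, ← mul_assoc, ← (hu.decProd_commute s t (m + 1) k).eq,
    mul_assoc _ _ (u k), hu.hElem_mul_gen, ← mul_sub, hdiff, mul_smul_comm]

theorem xProd_sub_swap_self (hu : IsNilCoxeter u) (X : ℕ → R) (m k : ℕ) :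
    xProd u X (m + 1) k - xProd u (X ∘ Equiv.swap k (k + 1)) (m + 1) k =
      (X k - X (k + 1)) • (xProd u X (m + 1) k * u k) := by
  have htail : xProd u (X ∘ Equiv.swap k (k + 1)) (m - 1) (k + 2) = xProd u X (m - 1) (k + 2) :=
    xProd_congr u fun i hi => congrArg X (Equiv.swap_apply_of_ne_of_ne (by omega) (by omega))
  have hcomm : u k * xProd u X (m - 1) (k + 2) = xProd u X (m - 1) (k + 2) * u k :=
    commute_xProd (fun i hi => hu.comm k i hi) X (m - 1)
  simp only [xProd, xProd_eq_decProd_mul u _ m, htail, Function.comp_apply, Equiv.swap_apply_left,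
    Equiv.swap_apply_right]
  rw [← mul_assoc, ← mul_assoc, ← sub_mul, hu.decProd_mul_decProd_sub, smul_mul_assoc,
    mul_assoc _ (u k), hcomm, ← mul_assoc]

theorem xProd_sub_swap (hu : IsNilCoxeter u) (X : ℕ → R) {m k i : ℕ} (hki : k ≤ i)
    (him : i < k + m) :
    xProd u X m k - xProd u (X ∘ Equiv.swap i (i + 1)) m k =
      (X i - X (i + 1)) • (xProd u X m k * u i) := by
  induction m generalizing k with
  | zero => omega
  | succ m ih =>
    obtain rfl | hlt := hki.eq_or_lt
    · exact hu.xProd_sub_swap_self X m k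
    · have hfix : (X ∘ Equiv.swap i (i + 1)) k = X k :=
        congrArg X (Equiv.swap_apply_of_ne_of_ne (by omega) (by omega))
      rw [xProd, xProd, hfix, ← mul_sub, ih hlt (by omega), mul_smul_comm, mul_assoc]

end IsNilCoxeter

/-! ### The regular representation of the nilCoxeter algebra -/

section Representation

open Classical in
/-- The matrix of right multiplication by the generator `u_i` on the nilCoxeter algebra of `S_n`,
which has the permutations as a basis: `v u_i = v s_i` if this lengthens `v`, and `v u_i = 0`
otherwise. Rows record images, so that matrices multiply in the order of the letters. -/
noncomputable def genMat (n : ℕ) (R : Type*) [CommRing R] (i : ℕ) :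
    Matrix (Equiv.Perm (Fin n)) (Equiv.Perm (Fin n)) R :=
  Matrix.of fun v w => if IsAscent v i ∧ w = v * simple n i then 1 else 0

variable {n : ℕ} {R : Type*} [CommRing R]

theorem len_one (n : ℕ) : len (1 : Equiv.Perm (Fin n)) = 0 := by
  rw [len_eq, card_invSet_one]

theorem len_mul_simple_le (v : Equiv.Perm (Fin n)) {i : ℕ} (h1 : 1 ≤ i) (h2 : i < n) :
    len (v * simple n i) ≤ len v + 1 := by
  rw [len_eq, len_eq]
  exact card_invSet_le v h1 h2

theorem simple_inv (n i : ℕ) : (simple n i)⁻¹ = simple n i :=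
  inv_eq_of_mul_eq_one_left (simple_mul_self n i)

theorem isWord_cons {w : Equiv.Perm (Fin n)} {a : ℕ} {e : List ℕ} :
    IsWord w (a :: e) ↔ (1 ≤ a ∧ a < n) ∧ IsWord (simple n a * w) e := by
  rw [← simple_inv n a, IsWord, IsWord, List.forall_mem_cons, List.map_cons, List.prod_cons,
    eq_inv_mul_iff_mul_eq, and_assoc]

theorem len_le_add_length {v w : Equiv.Perm (Fin n)} {e : List ℕ} (h : IsWord (v⁻¹ * w) e) :
    len w ≤ len v + e.length := by
  induction e generalizing v with
  | nil => simp [inv_mul_eq_one.1 h.2.symm]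
  | cons a e ih =>
    obtain ⟨⟨h1, h2⟩, he⟩ := isWord_cons.1 h
    have hsplit : (v * simple n a)⁻¹ * w = simple n a * (v⁻¹ * w) := by
      rw [mul_inv_rev, simple_inv, mul_assoc]
    have := ih (hsplit ▸ he)
    have := len_mul_simple_le v h1 h2
    rw [List.length_cons]
    omega

open Classical in
theorem genMat_mul_apply (i : ℕ) (M : Matrix (Equiv.Perm (Fin n)) (Equiv.Perm (Fin n)) R)
    (v w : Equiv.Perm (Fin n)) :
    (genMat n R i * M) v w = if IsAscent v i then M (v * simple n i) w else 0 := by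
  rw [Matrix.mul_apply]
  by_cases h : IsAscent v i <;> simp [genMat, h]

theorem mul_genMat_apply (M : Matrix (Equiv.Perm (Fin n)) (Equiv.Perm (Fin n)) R)
    (v : Equiv.Perm (Fin n)) {w : Equiv.Perm (Fin n)} {i : ℕ} (h : IsAscent w i) :
    (M * genMat n R i) v (w * simple n i) = M v w := by
  rw [Matrix.mul_apply, Finset.sum_eq_single w]
  · simp [genMat, h]
  · intro b _ hb
    simp [genMat, hb.symm]
  · simp

theorem isWord_cons_and_len_iff {v w : Equiv.Perm (Fin n)} {a : ℕ} {e : List ℕ} :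
    IsWord (v⁻¹ * w) (a :: e) ∧ len w = len v + (a :: e).length ↔
      IsAscent v a ∧ IsWord ((v * simple n a)⁻¹ * w) e ∧
        len w = len (v * simple n a) + e.length := by
  have hsplit : simple n a * (v⁻¹ * w) = (v * simple n a)⁻¹ * w := by
    rw [mul_inv_rev, simple_inv, mul_assoc]
  rw [isWord_cons, hsplit, List.length_cons]
  constructor
  · rintro ⟨⟨⟨h1, h2⟩, he⟩, hl⟩
    have := len_le_add_length he
    have := len_mul_simple_le v h1 h2
    exact ⟨⟨h1, h2, by omega⟩, he, by omega⟩
  · rintro ⟨⟨h1, h2, ha⟩, he, hl⟩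
    exact ⟨⟨⟨h1, h2⟩, he⟩, by omega⟩

open Classical in
theorem prod_map_genMat_apply (e : List ℕ) (v w : Equiv.Perm (Fin n)) :
    (e.map (genMat n R)).prod v w =
      if IsWord (v⁻¹ * w) e ∧ len w = len v + e.length then 1 else 0 := by
  induction e generalizing v with
  | nil =>
    by_cases h : v = w
    · simp [IsWord, h]
    · simp [IsWord, h, eq_comm (a := (1 : Equiv.Perm (Fin n))), inv_mul_eq_one]
  | cons a e ih =>
    rw [List.map_cons, List.prod_cons, genMat_mul_apply, ih, ← ite_and]
    simp only [isWord_cons_and_len_iff]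

open Classical in
theorem prod_map_genMat_one_apply (e : List ℕ) (w : Equiv.Perm (Fin n)) :
    (e.map (genMat n R)).prod 1 w = if IsReducedWord w e then 1 else 0 := by
  rw [prod_map_genMat_apply, inv_one, one_mul, len_one, zero_add]
  exact if_congr (and_congr_right' eq_comm) rfl rfl

theorem sum_prod_genMat_apply {ws : List (List ℕ)} (hws : ws.Nodup)
    (w : Equiv.Perm (Fin n)) :
    (ws.map fun e => (e.map (genMat n R)).prod).sum 1 w =
      ({e | IsReducedWord w e ∧ e ∈ ws}.ncard : R) := by
  classical
  have hset : {e | IsReducedWord w e ∧ e ∈ ws} = ↑(ws.toFinset.filter (IsReducedWord w)) := by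
    ext e
    simp [and_comm]
  rw [hset, Set.ncard_coe_finset, ← Finset.sum_boole, ← List.sum_toFinset _ hws,
    Matrix.sum_apply]
  exact Finset.sum_congr rfl fun e _ => prod_map_genMat_one_apply e w

theorem prod_map_genMat_congr {e e' : List ℕ} (hl : e.length = e'.length)
    (he : ∀ w : Equiv.Perm (Fin n), IsWord w e ↔ IsWord w e') :
    (e.map (genMat n R)).prod = (e'.map (genMat n R)).prod := by
  ext v w
  classical
  rw [prod_map_genMat_apply, prod_map_genMat_apply]
  exact if_congr (by rw [he, hl]) rfl rfl

theorem genMat_mul_self (i : ℕ) : genMat n R i * genMat n R i = 0 := by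
  ext v w
  have h := prod_map_genMat_apply (R := R) [i, i] v w
  rw [if_neg] at h
  · simpa using h
  · rintro ⟨⟨-, hprod⟩, hlen⟩
    have hvw : v = w := inv_mul_eq_one.1 (by simpa [simple_mul_self] using hprod.symm)
    simp [hvw] at hlen

theorem genMat_comm {i j : ℕ} (h : i + 2 ≤ j) : Commute (genMat n R i) (genMat n R j) := by
  have key : ([i, j].map (genMat n R)).prod = ([j, i].map (genMat n R)).prod := by
    refine prod_map_genMat_congr rfl fun w => ?_
    simp only [IsWord, List.forall_mem_cons, List.map_cons, List.map_nil, List.prod_cons,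
      List.prod_nil, mul_one]
    constructor
    · rintro ⟨⟨hi, hj, hnil⟩, rfl⟩
      exact ⟨⟨hj, hi, hnil⟩, (simple_comm hi.1 hi.2 hj.1 hj.2 h).symm⟩
    · rintro ⟨⟨hj, hi, hnil⟩, rfl⟩
      exact ⟨⟨hi, hj, hnil⟩, simple_comm hi.1 hi.2 hj.1 hj.2 h⟩
  simpa [Commute, SemiconjBy] using key

theorem genMat_braid (i : ℕ) :
    genMat n R i * genMat n R (i + 1) * genMat n R i =
      genMat n R (i + 1) * genMat n R i * genMat n R (i + 1) := by
  have key : ([i, i + 1, i].map (genMat n R)).prod = ([i + 1, i, i + 1].map (genMat n R)).prod := by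
    refine prod_map_genMat_congr rfl fun w => ?_
    simp only [IsWord, List.forall_mem_cons, List.map_cons, List.map_nil, List.prod_cons,
      List.prod_nil, mul_one, ← mul_assoc]
    constructor
    · rintro ⟨⟨hi, hj, -, hnil⟩, rfl⟩
      exact ⟨⟨hj, hi, hj, hnil⟩, (simple_braid hi.1 hj.2).symm⟩
    · rintro ⟨⟨hj, hi, -, hnil⟩, rfl⟩
      exact ⟨⟨hi, hj, hi, hnil⟩, simple_braid hi.1 hj.2⟩
  simpa [mul_assoc] using key

variable (n R) in
theorem isNilCoxeter_genMat : IsNilCoxeter (genMat n R) :=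
  ⟨genMat_mul_self, fun _ _ => genMat_comm, genMat_braid⟩

theorem map_smul_genMat {S : Type*} [CommRing S] (φ : R →+* S) (t : R) (i : ℕ) :
    φ.mapMatrix (t • genMat n R i) = φ t • genMat n S i := by
  ext v w
  simp [genMat, apply_ite φ]

open Classical in
theorem factorProd_genMat_cons_apply (p : ℕ × R) (L : List (ℕ × R)) (v w : Equiv.Perm (Fin n)) :
    factorProd (genMat n R) (p :: L) v w = factorProd (genMat n R) L v w +
      if IsAscent v p.1 then p.2 * factorProd (genMat n R) L (v * simple n p.1) w else 0 := by
  rw [factorProd_cons, hElem, add_mul, one_mul, smul_mul_assoc, Matrix.add_apply,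
    Matrix.smul_apply, genMat_mul_apply, smul_ite, smul_zero, smul_eq_mul]

theorem factorProd_genMat_apply_of_lt {L : List (ℕ × R)} {v w : Equiv.Perm (Fin n)}
    (h : len v + L.length < len w) : factorProd (genMat n R) L v w = 0 := by
  induction L generalizing v with
  | nil =>
    have hne : v ≠ w := by
      rintro rfl
      simp at h
    simp [factorProd, hne]
  | cons p L ih =>
    rw [List.length_cons] at h
    rw [factorProd_genMat_cons_apply, ih (by omega), zero_add]
    split_ifs with ha
    · rw [ih (by have := ha.2.2; omega), mul_zero]
    · rfl

theorem factorProd_genMat_apply_of_eq {L : List (ℕ × R)} {v w : Equiv.Perm (Fin n)}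
    (h : len w = len v + L.length) : factorProd (genMat n R) L v w =
      (L.map Prod.snd).prod * ((L.map Prod.fst).map (genMat n R)).prod v w := by
  induction L generalizing v with
  | nil => simp [factorProd]
  | cons p L ih =>
    rw [List.length_cons] at h
    simp only [List.map_cons, List.prod_cons]
    rw [factorProd_genMat_cons_apply, factorProd_genMat_apply_of_lt (by omega), zero_add,
      genMat_mul_apply]
    split_ifs with ha
    · rw [ih (by have := ha.2.2; omega), mul_assoc]
    · rw [mul_zero]

end Representation

/-! ### The staircase word of the longest permutation -/

section Staircase

variable {R : Type*} [CommRing R]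

theorem map_fst_rowFactors (t : R) (Y : ℕ → R) (m k j : ℕ) :
    (rowFactors t Y m k j).map Prod.fst = (List.range' k m).reverse := by
  induction m generalizing k j with
  | zero => rfl
  | succ m ih =>
    rw [rowFactors, List.map_append, ih, List.range'_succ, List.reverse_cons]
    rfl

theorem prod_map_snd_rowFactors (t : R) (Y : ℕ → R) (m k j : ℕ) :
    ((rowFactors t Y m k j).map Prod.snd).prod = ∏ r ∈ Finset.Ico j (j + m), (t - Y r) := by
  induction m generalizing k j with
  | zero => simp [rowFactors]
  | succ m ih =>
    rw [rowFactors, List.map_append, List.prod_append, ih, List.map_singleton, List.prod_singleton,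
      Finset.prod_eq_prod_Ico_succ_bot (b := j + (m + 1)) (by omega), mul_comm, add_assoc j 1 m,
      add_comm 1 m]

theorem prod_map_snd_staircase (X Y : ℕ → R) (j m k : ℕ) :
    ((staircase X Y j m k).map Prod.snd).prod =
      ∏ i ∈ Finset.Ico k (k + m), ∏ r ∈ Finset.Ico j (j + (k + m - i)), (X i - Y r) := by
  induction m generalizing k with
  | zero => simp [staircase]
  | succ m ih =>
    rw [staircase, List.map_append, List.prod_append, ih, prod_map_snd_rowFactors,
      Finset.prod_eq_prod_Ico_succ_bot (b := k + (m + 1)) (by omega), Nat.add_sub_cancel_left,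
      add_assoc k 1 m, add_comm 1 m]

theorem length_staircase (X Y : ℕ → R) (j m k : ℕ) :
    (staircase X Y j m k).length = ∑ r ∈ Finset.range (m + 1), r := by
  induction m generalizing k with
  | zero => rfl
  | succ m ih =>
    rw [staircase, List.length_append, ← List.length_map Prod.fst, map_fst_rowFactors,
      List.length_reverse, List.length_range', ih, Finset.sum_range_succ _ (m + 1), add_comm]

theorem mem_map_fst_staircase {X Y : ℕ → R} {j m k a : ℕ}
    (ha : a ∈ (staircase X Y j m k).map Prod.fst) : k ≤ a ∧ a < k + m := by
  induction m generalizing k with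
  | zero => simp [staircase] at ha
  | succ m ih =>
    rw [staircase, List.map_append, List.mem_append, map_fst_rowFactors, List.mem_reverse,
      List.mem_range'_1] at ha
    rcases ha with hrow | hrest
    · exact hrow
    · have := ih hrest
      omega

theorem val_simple_apply {n i : ℕ} (h1 : 1 ≤ i) (h2 : i < n) (c : Fin n) :
    (simple n i c : ℕ) =
      if c.val = i - 1 then i else if c.val = i then i - 1 else c.val := by
  rw [simple_eq h1 h2, Equiv.swap_apply_def]
  simp only [Fin.ext_iff]
  split_ifs <;> rfl

theorem prod_simple_reverse_range'_apply {n : ℕ} (m k : ℕ) (hk : 1 ≤ k) (hn : k + m = n)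
    (c : Fin n) : ((((List.range' k m).reverse.map (simple n)).prod c : Fin n) : ℕ) =
      if c.val + 1 = k then n - 1 else if c.val + 1 < k then c.val else c.val - 1 := by
  have hc := c.2
  induction m generalizing k c with
  | zero =>
    simp only [List.range'_zero, List.reverse_nil, List.map_nil, List.prod_nil,
      Equiv.Perm.one_apply]
    split_ifs <;> omega
  | succ m ih =>
    rw [List.range'_succ, List.reverse_cons, List.map_append, List.prod_append,
      List.map_singleton, List.prod_singleton, Equiv.Perm.mul_apply,
      ih _ (by omega) (by omega) _ (Fin.is_lt _), val_simple_apply hk (by omega)]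
    split_ifs <;> omega

theorem prod_simple_staircase_apply {n : ℕ} (X Y : ℕ → R) (j m k : ℕ) (hk : 1 ≤ k)
    (hn : k + m = n) (c : Fin n) :
    (((((staircase X Y j m k).map Prod.fst).map (simple n)).prod c : Fin n) : ℕ) =
      if c.val + 1 < k then c.val else n + k - 2 - c.val := by
  have hc := c.2
  induction m generalizing k c with
  | zero =>
    simp only [staircase, List.map_nil, List.prod_nil, Equiv.Perm.one_apply]
    split_ifs <;> omega
  | succ m ih =>
    rw [staircase, List.map_append, List.map_append, List.prod_append, Equiv.Perm.mul_apply,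
      map_fst_rowFactors, prod_simple_reverse_range'_apply _ _ hk hn,
      ih _ (by omega) (by omega) _ hc]
    split_ifs <;> omega

theorem len_revPerm (n : ℕ) :
    len (Fin.revPerm : Equiv.Perm (Fin n)) = ∑ r ∈ Finset.range n, r := by
  have hinv : invSet (Fin.revPerm : Equiv.Perm (Fin n)) =
      ((Finset.univ : Finset (Fin n)).sigma fun a => Finset.Ioi a).map
        (Equiv.sigmaEquivProd (Fin n) (Fin n)).toEmbedding := by
    ext ⟨a, b⟩
    simp [mem_invSet]
  rw [len_eq, hinv, Finset.card_map, Finset.card_sigma, ← Finset.sum_range_reflect,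
    ← Fin.sum_univ_eq_sum_range (fun r => n - 1 - r)]
  simp [Fin.card_Ioi]

theorem isReducedWord_staircase (n : ℕ) (X Y : ℕ → R) (j : ℕ) :
    IsReducedWord (Fin.revPerm : Equiv.Perm (Fin n))
      ((staircase X Y j (n - 1) 1).map Prod.fst) := by
  refine ⟨⟨fun a ha => ?_, ?_⟩, ?_⟩
  · have := mem_map_fst_staircase ha
    omega
  · ext c
    have hc := c.2
    rw [prod_simple_staircase_apply X Y j (n - 1) 1 le_rfl (by omega), if_neg (by omega),
      Fin.revPerm_apply, Fin.val_rev]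
    omega
  · rw [List.length_map, length_staircase, len_revPerm]
    cases n <;> rfl

end Staircase

/-! ### Double Schubert polynomials as matrix entries -/

theorem topPoly_eq_prod_Ico (n : ℕ) :
    topPoly n = ∏ i ∈ Finset.Ico 1 n, ∏ j ∈ Finset.Ico 1 (1 + (n - i)), (x i - y j) := by
  refine Finset.prod_finset_product _ _ _ fun p => ?_
  simp only [Finset.mem_filter, Finset.mem_product, Finset.mem_Icc, Finset.mem_Ico]
  omega

/-- The matrix of right multiplication by the Fomin–Kirillov element `∑_w 𝔖_w(X; Y) w` of the
nilCoxeter algebra of `S_n`, in its factored form. -/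
noncomputable def schubertMat (n : ℕ) (X Y : ℕ → Poly) :
    Matrix (Equiv.Perm (Fin n)) (Equiv.Perm (Fin n)) Poly :=
  yProd (genMat n Poly) Y (n - 1) 1 1 * xProd (genMat n Poly) X (n - 1) 1

theorem schubertMat_one_revPerm (n : ℕ) : schubertMat n x y 1 Fin.revPerm = topPoly n := by
  have hword := isReducedWord_staircase n x y 1
  have hlen : len (Fin.revPerm : Equiv.Perm (Fin n)) =
      len (1 : Equiv.Perm (Fin n)) + (staircase x y 1 (n - 1) 1).length := by
    rw [len_one, zero_add, ← hword.2, List.length_map]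
  rw [schubertMat, (isNilCoxeter_genMat n Poly).yProd_mul_xProd, factorProd_genMat_apply_of_eq hlen,
    prod_map_genMat_one_apply, if_pos hword, mul_one, prod_map_snd_staircase, topPoly_eq_prod_Ico]
  rcases n with _ | n
  · rfl
  · rw [Nat.add_sub_cancel, add_comm 1 n]

theorem exch_comp_x (i : ℕ) : exch i ∘ x = x ∘ Equiv.swap i (i + 1) := by
  funext j
  simp only [Function.comp, exch_x, Equiv.swap_apply_def]
  split_ifs <;> rfl

theorem exch_comp_y (i : ℕ) : exch i ∘ y = y := by
  funext j
  simp [exch, y, swap_inr]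

theorem exch_schubertMat (n i : ℕ) (v w : Equiv.Perm (Fin n)) :
    exch i (schubertMat n x y v w) = schubertMat n (x ∘ Equiv.swap i (i + 1)) y v w := by
  have hgen : ∀ (t : Poly) (j : ℕ), (exch i : Poly →+* Poly).mapMatrix (t • genMat n Poly j) =
      (exch i : Poly →+* Poly) t • genMat n Poly j := map_smul_genMat _
  have hmap : (exch i : Poly →+* Poly).mapMatrix (schubertMat n x y) =
      schubertMat n (exch i ∘ x) (exch i ∘ y) := by
    rw [schubertMat, map_mul, map_yProd hgen, map_xProd hgen]
    rfl
  rw [← exch_comp_x]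
  nth_rewrite 2 [← exch_comp_y i]
  exact congrFun (congrFun hmap v) w

theorem schubertMat_sub_swap {n i : ℕ} (h1 : 1 ≤ i) (h2 : i < n) (X Y : ℕ → Poly) :
    schubertMat n X Y - schubertMat n (X ∘ Equiv.swap i (i + 1)) Y =
      (X i - X (i + 1)) • (schubertMat n X Y * genMat n Poly i) := by
  rw [schubertMat, schubertMat, ← mul_sub,
    (isNilCoxeter_genMat n Poly).xProd_sub_swap X h1 (by omega), mul_smul_comm, mul_assoc]

theorem divDiff_schubertMat {n i : ℕ} (h1 : 1 ≤ i) (h2 : i < n) (v w : Equiv.Perm (Fin n)) :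
    divDiff i (schubertMat n x y v w) = (schubertMat n x y * genMat n Poly i) v w := by
  apply mul_left_cancel₀ (x_sub_ne (show i ≠ i + 1 by omega))
  rw [divDiff_spec, exch_schubertMat]
  exact congrFun (congrFun (schubertMat_sub_swap h1 h2 x y) v) w

theorem doubleSchubert_eq_schubertMat {n : ℕ} (w : Equiv.Perm (Fin n)) :
    doubleSchubert w = schubertMat n x y 1 w := by
  induction hd : Finset.univ.sup (len (n := n)) - len w using Nat.strong_induction_on
    generalizing w with
  | _ d ih =>
    by_cases hw : w = Fin.revPerm
    · rw [hw, doubleSchubert_rev, schubertMat_one_revPerm]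
    · obtain ⟨i, hi⟩ := exists_isAscent w hw
      have hbound : len (w * simple n i) ≤ Finset.univ.sup (len (n := n)) :=
        Finset.le_sup (Finset.mem_univ _)
      have hlen := hi.2.2
      rw [doubleSchubert_eq w i hi, ih _ (by omega) _ rfl, divDiff_schubertMat hi.1 hi.2.1,
        mul_genMat_apply _ _ hi]

/-! ### Coefficients of products of factors with one variable per block -/

section BlockWords

variable {α σ : Type*}

/-- The words obtained by choosing, for each `z` of the list in turn, `c z` letters from `L z` in
the order in which they occur there, and concatenating the choices. -/
def blockWords (L : σ → List α) (c : σ → ℕ) : List σ → List (List α)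
  | [] => [[]]
  | z :: zs => (List.sublistsLen (c z) (L z)).flatMap fun l => (blockWords L c zs).map (l ++ ·)

theorem mem_blockWords_cons {L : σ → List α} {c : σ → ℕ} {z : σ} {zs : List σ} {e : List α} :
    e ∈ blockWords L c (z :: zs) ↔
      ∃ l l', (l.Sublist (L z) ∧ l.length = c z) ∧ l' ∈ blockWords L c zs ∧ l ++ l' = e := by
  simp only [blockWords, List.mem_flatMap, List.mem_map, List.mem_sublistsLen, exists_and_left]

theorem nodup_blockWords {L : σ → List α} (hL : ∀ z, (L z).Nodup) (c : σ → ℕ) (zs : List σ) :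
    (blockWords L c zs).Nodup := by
  induction zs with
  | nil => exact List.nodup_singleton _
  | cons z zs ih =>
    refine List.nodup_flatMap.2 ⟨fun l _ => ih.map (List.append_right_injective l), ?_⟩
    refine (List.nodup_sublistsLen _ (hL z)).imp_of_mem fun {l l'} hl hl' hne => ?_
    simp only [Function.onFun, List.disjoint_left, List.mem_map]
    rintro _ ⟨e, -, rfl⟩ ⟨e', -, heq⟩
    have hlen : l'.length = l.length :=
      (List.mem_sublistsLen.1 hl').2.trans (List.mem_sublistsLen.1 hl).2.symm
    exact hne (List.append_inj heq hlen).1.symm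

theorem sum_map_prod_blockWords_cons {A : Type*} [Semiring A] (U : α → A) (L : σ → List α)
    (c : σ → ℕ) (z : σ) (zs : List σ) :
    ((blockWords L c (z :: zs)).map fun e => (e.map U).prod).sum =
      ((List.sublistsLen (c z) (L z)).map fun l => (l.map U).prod).sum *
        ((blockWords L c zs).map fun e => (e.map U).prod).sum := by
  rw [blockWords]
  induction List.sublistsLen (c z) (L z) with
  | nil => simp
  | cons l ls ih =>
    simp only [List.flatMap_cons, List.map_append, List.sum_append, ih, List.map_map,
      Function.comp_def, List.prod_append, List.sum_map_mul_left, List.map_cons, List.sum_cons,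
      add_mul]

end BlockWords

section Coefficients

open MvPolynomial

variable {α σ ι R : Type*} [CommRing R]

theorem coeff_eq_zero_of_mem_supported {p : MvPolynomial σ R} {z : σ} {d : σ →₀ ℕ}
    (hp : p ∈ supported R {z}ᶜ) (hd : d z ≠ 0) : coeff d p = 0 := by
  by_contra hne
  exact mem_supported.1 hp ((mem_vars_iff_mem_support z).2
    ⟨d, mem_support_iff.2 hne, Finsupp.mem_support_iff.2 hd⟩) rfl

variable [Fintype ι]

theorem map_coeff_map_C_mul (N : Matrix ι ι R) (M : Matrix ι ι (MvPolynomial σ R))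
    (d : σ →₀ ℕ) : (N.map C * M).map (coeff d) = N * M.map (coeff d) := by
  ext v w
  simp [Matrix.mul_apply, coeff_sum]

variable [DecidableEq ι]

theorem hElem_map_C_mul_apply (U : α → Matrix ι ι R) (a : R) (z : σ) (i : α)
    (M : Matrix ι ι (MvPolynomial σ R)) (v w : ι) :
    (hElem (fun i => (U i).map C) (C a * X z) i * M : Matrix ι ι (MvPolynomial σ R)) v w =
      M v w + X z * (C a * ((U i).map C * M : Matrix ι ι (MvPolynomial σ R)) v w) := by
  rw [hElem, add_mul, one_mul, Matrix.add_apply, smul_mul_assoc, Matrix.smul_apply, smul_eq_mul,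
    mul_comm (C a), mul_assoc]

theorem map_coeff_hElem_mul_of_apply_eq_zero (U : α → Matrix ι ι R) (a : R) {z : σ} (i : α)
    (M : Matrix ι ι (MvPolynomial σ R)) {d : σ →₀ ℕ} (hd : d z = 0) :
    (hElem (fun i => (U i).map C) (C a * X z) i * M : Matrix ι ι (MvPolynomial σ R)).map
      (coeff d) = M.map (coeff d) := by
  classical
  ext v w
  rw [Matrix.map_apply, hElem_map_C_mul_apply, coeff_add, coeff_X_mul',
    if_neg (by simpa using hd), add_zero, Matrix.map_apply]

theorem map_coeff_hElem_mul_single_add (U : α → Matrix ι ι R) (a : R) (z : σ) (i : α)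
    (M : Matrix ι ι (MvPolynomial σ R)) (d : σ →₀ ℕ) :
    (hElem (fun i => (U i).map C) (C a * X z) i * M : Matrix ι ι (MvPolynomial σ R)).map
        (coeff (Finsupp.single z 1 + d)) =
      M.map (coeff (Finsupp.single z 1 + d)) + a • (U i * M.map (coeff d)) := by
  ext v w
  rw [Matrix.map_apply, hElem_map_C_mul_apply, coeff_add, coeff_X_mul, coeff_C_mul,
    ← map_coeff_map_C_mul]
  rfl

theorem map_coeff_hProd_mul (U : α → Matrix ι ι R) (a : R) {z : σ} (L : List α)
    {P : Matrix ι ι (MvPolynomial σ R)} (hP : P ∈ (supported R {z}ᶜ).matrix) (c : ℕ)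
    {d : σ →₀ ℕ} (hd : d z = 0) :
    (hProd (fun i => (U i).map C) (C a * X z) L * P : Matrix ι ι (MvPolynomial σ R)).map
        (coeff (Finsupp.single z c + d)) =
      a ^ c • (((List.sublistsLen c L).map fun l => (l.map U).prod).sum * P.map (coeff d)) := by
  induction L generalizing c with
  | nil =>
    rw [hProd_nil, one_mul]
    cases c with
    | zero => simp
    | succ c =>
      ext v w
      simpa using coeff_eq_zero_of_mem_supported (hP v w) (by simp)
  | cons i L ih =>
    rw [hProd_cons, mul_assoc]
    cases c with
    | zero =>
      rw [map_coeff_hElem_mul_of_apply_eq_zero _ _ _ _ (by simpa using hd), ih,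
        List.sublistsLen_zero, List.sublistsLen_zero]
    | succ c =>
      have hsplit :
          Finsupp.single z (c + 1) + d = Finsupp.single z 1 + (Finsupp.single z c + d) := by
        rw [← add_assoc, ← Finsupp.single_add, add_comm 1 c]
      rw [hsplit, map_coeff_hElem_mul_single_add, ← hsplit, ih, ih, List.sublistsLen_succ_cons,
        List.map_append, List.sum_append, List.map_map]
      simp only [Function.comp_def, List.map_cons, List.prod_cons, List.sum_map_mul_left, add_mul,
        smul_add, Matrix.mul_smul, smul_smul, pow_succ', mul_assoc]

theorem hProd_mem_matrix_supported (U : α → Matrix ι ι R) (a : R) {z : σ} {s : Set σ} (hz : z ∈ s)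
    (L : List α) :
    hProd (fun i => (U i).map C) (C a * X z) L ∈ (supported R s).matrix := by
  refine Subalgebra.list_prod_mem _ fun M hM => ?_
  obtain ⟨i, -, rfl⟩ := List.mem_map.1 hM
  exact add_mem (one_mem _) fun v w => (supported R s).mul_mem
    ((supported R s).mul_mem ((supported R s).algebraMap_mem a)
      (Algebra.subset_adjoin ⟨z, hz, rfl⟩)) ((supported R s).algebraMap_mem (U i v w))

theorem map_coeff_prod_hProd (U : α → Matrix ι ι R) (a : σ → R) (L : σ → List α) (c : σ → ℕ)
    {zs : List σ} (hzs : zs.Nodup) :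
    ((zs.map fun z => hProd (fun i => (U i).map C) (C (a z) * X z) (L z)).prod).map
        (coeff (zs.map fun z => Finsupp.single z (c z)).sum) =
      (zs.map fun z => a z ^ c z).prod •
        ((blockWords L c zs).map fun e => (e.map U).prod).sum := by
  induction zs with
  | nil =>
    ext v w
    simp [blockWords, Matrix.one_apply, apply_ite (coeff 0)]
  | cons z zs ih =>
    obtain ⟨hz, hzs⟩ := List.nodup_cons.1 hzs
    have hsupp : (zs.map fun z => hProd (fun i => (U i).map C) (C (a z) * X z) (L z)).prod ∈
        (supported R {z}ᶜ).matrix := by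
      refine Subalgebra.list_prod_mem _ fun M hM => ?_
      obtain ⟨z', hz', rfl⟩ := List.mem_map.1 hM
      exact hProd_mem_matrix_supported U (a z') (ne_of_mem_of_not_mem hz' hz) (L z')
    have hexp : (zs.map fun z => Finsupp.single z (c z)).sum z = 0 := by
      rw [← Finsupp.applyAddHom_apply, map_list_sum, List.map_map]
      refine List.sum_eq_zero fun m hm => ?_
      obtain ⟨z', hz', rfl⟩ := List.mem_map.1 hm
      exact Finsupp.single_eq_of_ne (ne_of_mem_of_not_mem hz' hz).symm
    simp only [List.map_cons, List.prod_cons, List.sum_cons]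
    rw [map_coeff_hProd_mul U (a z) (L z) hsupp (c z) hexp, ih hzs, sum_map_prod_blockWords_cons,
      Matrix.mul_smul, smul_smul]

end Coefficients

/-! ### The conditions on the blocks of a word -/

section Blocks

theorem getElem_extract_eq_letter {e : List ℕ} {a b j : ℕ} (hj : j < (e.extract a b).length) :
    (e.extract a b)[j] = letter e (a + j + 1) := by
  have hlen : a + j < e.length := by
    simp only [List.extract_eq_take_drop, List.length_take, List.length_drop] at hj
    omega
  simp [letter, hlen]

theorem length_extract_of_le {α : Type*} {e : List α} {a b : ℕ} (hb : b ≤ e.length) :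
    (e.extract a b).length = b - a := by
  rw [List.extract_eq_take_drop, List.length_take, List.length_drop]
  omega

theorem isChain_extract_iff {r : ℕ → ℕ → Prop} {e : List ℕ} {a b : ℕ} (hb : b ≤ e.length) :
    (e.extract a b).IsChain r ↔ ∀ k, a < k → k < b → r (letter e k) (letter e (k + 1)) := by
  have hlen : (e.extract a b).length = b - a := length_extract_of_le hb
  simp only [List.isChain_iff_getElem, getElem_extract_eq_letter, hlen]
  constructor
  · intro h k hak hkb
    obtain ⟨j, rfl⟩ := Nat.exists_eq_add_of_lt hak
    exact h j (by omega)
  · exact fun h j hj => h (a + j + 1) (by omega) (by omega)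

theorem forall_mem_le_iff_of_pairwise_lt {l : List ℕ} (hl : l.Pairwise (· < ·)) (m : ℕ) :
    (∀ x ∈ l, m ≤ x) ↔ ∀ h : 0 < l.length, m ≤ l[0] := by
  refine ⟨fun h hpos => h _ (List.getElem_mem hpos), fun h x hx => ?_⟩
  obtain ⟨i, hi, rfl⟩ := List.getElem_of_mem hx
  exact (h (by omega)).trans (hl.sortedLT.getElem_le_getElem_iff.2 (Nat.zero_le i))

theorem forall_mem_le_iff_of_pairwise_gt {l : List ℕ} (hl : l.Pairwise (· > ·)) (m : ℕ) :
    (∀ x ∈ l, m ≤ x) ↔ ∀ _ : 0 < l.length, m ≤ l[l.length - 1] := by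
  refine ⟨fun h hpos => h _ (List.getElem_mem _), fun h x hx => ?_⟩
  obtain ⟨i, hi, rfl⟩ := List.getElem_of_mem hx
  exact (h (by omega)).trans (hl.sortedGT.getElem_le_getElem_iff.2 (by omega))

theorem incBlock_iff {e : List ℕ} {m a b : ℕ} (hb : b ≤ e.length) :
    IncBlock e m a b ↔
      (e.extract a b).Pairwise (· < ·) ∧ ∀ k ∈ e.extract a b, m ≤ k := by
  have hlen : (e.extract a b).length = b - a := length_extract_of_le hb
  rw [IncBlock, and_comm, ← isChain_extract_iff hb, List.isChain_iff_pairwise]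
  refine and_congr_right fun hl => ?_
  simp only [forall_mem_le_iff_of_pairwise_lt hl, getElem_extract_eq_letter, hlen, add_zero,
    Nat.sub_pos_iff_lt]

theorem decBlock_iff {e : List ℕ} {m a b : ℕ} (hb : b ≤ e.length) :
    DecBlock e m a b ↔
      (e.extract a b).Pairwise (· > ·) ∧ ∀ k ∈ e.extract a b, m ≤ k := by
  have hlen : (e.extract a b).length = b - a := length_extract_of_le hb
  rw [DecBlock, ← List.isChain_iff_pairwise, isChain_extract_iff hb]
  refine and_congr_right fun hl => ?_
  rw [← isChain_extract_iff (r := (· > ·)) hb, List.isChain_iff_pairwise] at hl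
  simp only [forall_mem_le_iff_of_pairwise_gt hl, getElem_extract_eq_letter, hlen,
    Nat.sub_pos_iff_lt]
  refine forall_congr' fun hab => ?_
  rw [show a + (b - a - 1) + 1 = b by omega]

theorem sublist_range'_iff {l : List ℕ} {k m : ℕ} :
    l.Sublist (List.range' k m) ↔ l.Pairwise (· < ·) ∧ ∀ a ∈ l, k ≤ a ∧ a < k + m := by
  constructor
  · intro h
    exact ⟨(List.pairwise_lt_range' 1).sublist h, fun a ha => by simpa using h.subset ha⟩
  · rintro ⟨hl, hmem⟩
    exact List.sublist_of_subperm_of_pairwise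
      (List.subperm_of_subset (hl.imp ne_of_lt) fun a ha => by simpa using hmem a ha) hl
      (List.pairwise_lt_range' 1)

theorem sublist_range'_reverse_iff {l : List ℕ} {k m : ℕ} :
    l.Sublist (List.range' k m).reverse ↔
      l.Pairwise (· > ·) ∧ ∀ a ∈ l, k ≤ a ∧ a < k + m := by
  rw [← List.reverse_reverse l, List.reverse_sublist, sublist_range'_iff, List.pairwise_reverse]
  simp only [List.reverse_reverse, List.mem_reverse]

variable {n m a b : ℕ} {e : List ℕ}

theorem forall_mem_extract_range'_iff (he : ∀ k ∈ e, k < n) :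
    (∀ k ∈ e.extract a b, m ≤ k ∧ k < m + (n - m)) ↔ ∀ k ∈ e.extract a b, m ≤ k := by
  refine forall₂_congr fun k hk => ?_
  have := he k (List.mem_of_mem_drop (List.mem_of_mem_take hk))
  omega

theorem extract_sublist_range'_iff (hb : b ≤ e.length) (he : ∀ k ∈ e, k < n) :
    (e.extract a b).Sublist (List.range' m (n - m)) ↔ IncBlock e m a b := by
  rw [sublist_range'_iff, incBlock_iff hb, forall_mem_extract_range'_iff he]

theorem extract_sublist_range'_reverse_iff (hb : b ≤ e.length) (he : ∀ k ∈ e, k < n) :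
    (e.extract a b).Sublist (List.range' m (n - m)).reverse ↔ DecBlock e m a b := by
  rw [sublist_range'_reverse_iff, decBlock_iff hb, forall_mem_extract_range'_iff he]

end Blocks

section Cuts

variable {α σ : Type*} {L : σ → List α} {c : σ → ℕ} {e : List α}

theorem drop_mem_blockWords_cons {z : σ} {zs : List σ} {o : ℕ} (h : o + c z ≤ e.length) :
    e.drop o ∈ blockWords L c (z :: zs) ↔
      (e.extract o (o + c z)).Sublist (L z) ∧ e.drop (o + c z) ∈ blockWords L c zs := by
  rw [mem_blockWords_cons, List.extract_eq_take_drop, Nat.add_sub_cancel_left]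
  constructor
  · rintro ⟨l, l', ⟨hl, hlen⟩, hl', heq⟩
    rw [← List.drop_drop, ← heq, ← hlen, List.take_left, List.drop_left]
    exact ⟨hl, hl'⟩
  · rintro ⟨hl, hl'⟩
    refine ⟨_, _, ⟨hl, ?_⟩, hl', ?_⟩
    · rw [List.length_take, List.length_drop]
      omega
    · rw [← List.drop_drop, List.take_append_drop]

theorem drop_mem_blockWords_append {z : ℕ → σ} {zs : List σ} {s : ℕ → ℕ} {k p : ℕ}
    (hs : ∀ i, i < k + p → s (i + 1) = s i + c (z (i + 1)))
    (hle : ∀ i, i ≤ k + p → s i ≤ e.length) :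
    e.drop (s k) ∈ blockWords L c ((List.range' (k + 1) p).map z ++ zs) ↔
      (∀ i, k < i → i ≤ k + p → (e.extract (s (i - 1)) (s i)).Sublist (L (z i))) ∧
        e.drop (s (k + p)) ∈ blockWords L c zs := by
  induction p generalizing k with
  | zero => simpa using fun _ i hki hik => absurd hki (by omega)
  | succ p ih =>
    have hk := hs k (by omega)
    rw [List.range'_succ, List.map_cons, List.cons_append,
      drop_mem_blockWords_cons (hk ▸ hle (k + 1) (by omega)), ← hk,
      ih (fun i hi => hs i (by omega)) fun i hi => hle i (by omega), ← and_assoc,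
      Nat.add_right_comm k 1 p]
    refine and_congr_left fun _ => ⟨fun h i hki hik => ?_, fun h => ⟨?_, fun i hki hik => ?_⟩⟩
    · rcases Nat.eq_or_lt_of_le (Nat.succ_le_of_lt hki) with rfl | hki
      · exact h.1
      · exact h.2 i hki hik
    · exact h (k + 1) (by omega) (by omega)
    · exact h i (by omega) hik

end Cuts

section Sums

variable {n : ℕ} (u v : ℕ → ℕ)

theorem gSum_zero : gSum n v 0 = 0 := by
  simp [gSum]

theorem gSum_succ {i : ℕ} (h : i + 1 ≤ n) :
    gSum n v (i + 1) = gSum n v i + v (n - (i + 1)) := by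
  rw [gSum, gSum, Finset.sum_eq_sum_Ico_succ_bot (by omega), add_comm,
    show n - (i + 1) + 1 = n - i by omega]

theorem fSum_succ (i : ℕ) : fSum n u v (i + 1) = fSum n u v i + u (i + 1) := by
  rw [fSum, fSum, Finset.sum_Icc_succ_top (by omega), add_assoc]

theorem gSum_mono : Monotone (gSum n v) := fun _ _ h =>
  Finset.sum_le_sum_of_subset (Finset.Ico_subset_Ico (by omega) le_rfl)

theorem fSum_mono : Monotone (fSum n u v) := fun _ _ h =>
  Nat.add_le_add_left (Finset.sum_le_sum_of_subset (Finset.Icc_subset_Icc le_rfl h)) _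

theorem fSum_zero : fSum n u v 0 = gSum n v (n - 1) := by
  simp [fSum]

theorem gSum_pred : gSum n v (n - 1) = ∑ k ∈ Finset.Ico 1 n, v k := by
  rcases n with _ | n
  · rfl
  · simp [gSum]

theorem fSum_pred : fSum n u v (n - 1) = ∑ k ∈ Finset.Ico 1 n, (u k + v k) := by
  rw [fSum, gSum_pred, Finset.sum_add_distrib, add_comm]
  cases n <;> rfl

end Sums

/-! ### One block of factors for each variable -/

section BlockProduct

open MvPolynomial

/-- The variables `y_{n-1}, …, y_1, x_1, …, x_{n-1}`, in the order in which their factors occur in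
`schubertMat n x y`. -/
def blockVars (n : ℕ) : List (ℕ ⊕ ℕ) :=
  (List.range' 1 (n - 1)).reverse.map Sum.inr ++ (List.range' 1 (n - 1)).map Sum.inl

/-- The letters of the factors of `schubertMat n x y` that contain a given variable, in the order
in which they occur. -/
def blockLetters (n : ℕ) : ℕ ⊕ ℕ → List ℕ
  | .inl i => (List.range' i (n - i)).reverse
  | .inr j => List.range' j (n - j)

/-- The sign with which a variable enters the factors of `schubertMat n x y`. -/
def blockSign : ℕ ⊕ ℕ → ℤ := Sum.elim (fun _ => 1) fun _ => -1

theorem nodup_blockVars (n : ℕ) : (blockVars n).Nodup := by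
  have hrange : (List.range' 1 (n - 1)).Nodup := List.nodup_range'
  refine ((List.nodup_reverse.2 hrange).map Sum.inr_injective).append
    (hrange.map Sum.inl_injective) ?_
  simp [List.disjoint_left]

theorem nodup_blockLetters (n : ℕ) : ∀ z, (blockLetters n z).Nodup
  | .inl _ => List.nodup_reverse.2 List.nodup_range'
  | .inr _ => List.nodup_range'

theorem expVec_eq_sum_blockVars (n : ℕ) (u v : ℕ → ℕ) :
    expVec n u v = ((blockVars n).map fun z => Finsupp.single z (Sum.elim u v z)).sum := by
  rw [expVec, Finset.sum_add_distrib, add_comm, blockVars, List.map_append, List.sum_append,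
    List.map_reverse, List.map_reverse, List.sum_reverse, List.map_map, List.map_map]
  rfl

theorem prod_blockSign_pow (n : ℕ) (u v : ℕ → ℕ) :
    ((blockVars n).map fun z => blockSign z ^ Sum.elim u v z).prod = (-1) ^ gSum n v (n - 1) := by
  rw [gSum_pred, ← Finset.prod_pow_eq_pow_sum, blockVars, List.map_append, List.prod_append,
    List.map_reverse, List.map_reverse, List.prod_reverse, List.map_map, List.map_map]
  simp only [blockSign, Function.comp_def, Sum.elim_inl, Sum.elim_inr, one_pow, List.map_const',
    List.prod_replicate, mul_one]
  rfl

variable {R A : Type*} [CommRing R] [Ring A] [Algebra R A]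

theorem xProd_eq_prod (u : ℕ → A) (X : ℕ → R) (m k : ℕ) :
    xProd u X m k = ((List.range' k m).map fun i => decProd u (X i) (k + m - i) i).prod := by
  induction m generalizing k with
  | zero => rfl
  | succ m ih =>
    rw [xProd, ih, List.range'_succ, List.map_cons, List.prod_cons, Nat.add_sub_cancel_left,
      Nat.add_right_comm k 1 m, Nat.add_assoc k m 1]

theorem yProd_eq_prod (u : ℕ → A) (Y : ℕ → R) (m k : ℕ) :
    yProd u Y m k k =
      ((List.range' k m).reverse.map fun i => incProd u (-Y i) (k + m - i) i).prod := by
  induction m generalizing k with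
  | zero => rfl
  | succ m ih =>
    rw [yProd, ih, List.range'_succ, List.reverse_cons, List.map_append, List.prod_append,
      List.map_singleton, List.prod_singleton, Nat.add_sub_cancel_left,
      Nat.add_right_comm k 1 m, Nat.add_assoc k m 1]

theorem schubertMat_eq_prod_blockVars (n : ℕ) :
    schubertMat n x y = ((blockVars n).map fun z =>
      hProd (fun i => (genMat n ℤ i).map C) (C (blockSign z) * X z) (blockLetters n z)).prod := by
  have hgen : (fun i => (genMat n ℤ i).map C) = genMat n Poly := by
    funext i
    simpa using map_smul_genMat (n := n) (C : ℤ →+* Poly) 1 i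
  have hlen : ∀ i ∈ List.range' 1 (n - 1), 1 + (n - 1) - i = n - i := by
    simp only [List.mem_range'_1]
    omega
  rw [hgen, schubertMat, yProd_eq_prod, xProd_eq_prod, blockVars, List.map_append, List.prod_append,
    List.map_map, List.map_map]
  congr 2
  · refine List.map_congr_left fun j hj => ?_
    rw [hlen j (List.mem_reverse.1 hj)]
    simp [incProd, blockSign, blockLetters, y]
  · refine List.map_congr_left fun i hi => ?_
    rw [hlen i hi]
    simp [decProd, blockSign, blockLetters, x]

theorem map_inr_reverse_range' (n : ℕ) :
    (List.range' 1 (n - 1)).reverse.map (Sum.inr : ℕ → ℕ ⊕ ℕ) =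
      (List.range' 1 (n - 1)).map fun i => Sum.inr (n - i) := by
  refine List.ext_getElem (by simp) fun i hi _ => ?_
  simp only [List.length_map, List.length_reverse, List.length_range'] at hi
  simp only [List.getElem_map, List.getElem_reverse, List.getElem_range', List.length_range']
  congr 1
  omega

theorem mem_blockWords_blockVars_iff {n : ℕ} {u v : ℕ → ℕ} {e : List ℕ}
    (hlen : e.length = ∑ k ∈ Finset.Ico 1 n, (u k + v k)) (he : ∀ k ∈ e, k < n) :
    e ∈ blockWords (blockLetters n) (Sum.elim u v) (blockVars n) ↔
      ∀ i, 1 ≤ i → i ≤ n - 1 → IncBlock e (n - i) (gSum n v (i - 1)) (gSum n v i) ∧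
        DecBlock e i (fSum n u v (i - 1)) (fSum n u v i) := by
  have hf : ∀ i ≤ n - 1, fSum n u v i ≤ e.length := fun i hi => by
    rw [hlen, ← fSum_pred]
    exact fSum_mono u v hi
  have hg : ∀ i ≤ n - 1, gSum n v i ≤ e.length := fun i hi =>
    (gSum_mono v hi).trans (fSum_zero (n := n) u v ▸ hf 0 (Nat.zero_le _))
  have hinc := drop_mem_blockWords_append (e := e) (L := blockLetters n) (c := Sum.elim u v)
    (z := fun i => Sum.inr (n - i)) (zs := (List.range' 1 (n - 1)).map Sum.inl) (s := gSum n v)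
    (k := 0) (p := n - 1) (fun i hi => gSum_succ v (by omega)) (fun i hi => hg i (by omega))
  have hdec := drop_mem_blockWords_append (e := e) (L := blockLetters n) (c := Sum.elim u v)
    (z := Sum.inl) (zs := []) (s := fSum n u v) (k := 0) (p := n - 1)
    (fun i _ => fSum_succ u v i) (fun i hi => hf i (by omega))
  simp only [zero_add, List.append_nil, gSum_zero, fSum_zero, fSum_pred, ← hlen, List.drop_zero,
    List.drop_length, blockWords, List.mem_singleton, and_true] at hinc hdec
  rw [blockVars, map_inr_reverse_range', hinc, hdec]
  simp only [← forall_and]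
  exact forall₃_congr fun i _ hi => and_congr
    (extract_sublist_range'_iff (hg i hi) he) (extract_sublist_range'_reverse_iff (hf i hi) he)

theorem coeff_doubleSchubert {n : ℕ} (w : Equiv.Perm (Fin n)) (u v : ℕ → ℕ) :
    coeff (expVec n u v) (doubleSchubert w) = (-1) ^ gSum n v (n - 1) *
      ({e | IsReducedWord w e ∧
        e ∈ blockWords (blockLetters n) (Sum.elim u v) (blockVars n)}.ncard : ℤ) := by
  have hcoeff := congrFun (congrFun (map_coeff_prod_hProd (genMat n ℤ) blockSign (blockLetters n)
    (Sum.elim u v) (nodup_blockVars n)) 1) w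
  rw [← schubertMat_eq_prod_blockVars, ← expVec_eq_sum_blockVars, prod_blockSign_pow,
    Matrix.map_apply, Matrix.smul_apply, smul_eq_mul,
    sum_prod_genMat_apply (nodup_blockWords (nodup_blockLetters n) _ _)] at hcoeff
  rw [doubleSchubert_eq_schubertMat, hcoeff]

end BlockProduct

end DoubleSchubert

theorem mainTheorem6 (n : ℕ) (w : Equiv.Perm (Fin n)) (u v : ℕ → ℕ)
    (hdeg : ∑ k ∈ Finset.Ico 1 n, (u k + v k) = DoubleSchubert.len w) :
    MvPolynomial.coeff (DoubleSchubert.expVec n u v) (DoubleSchubert.doubleSchubert w) =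
      (-1 : ℤ) ^ DoubleSchubert.gSum n v (n - 1) *
        (Set.ncard {e : List ℕ | DoubleSchubert.IsReducedWord w e ∧
          ∀ i, 1 ≤ i → i ≤ n - 1 →
            DoubleSchubert.IncBlock e (n - i)
              (DoubleSchubert.gSum n v (i - 1)) (DoubleSchubert.gSum n v i) ∧
            DoubleSchubert.DecBlock e i
              (DoubleSchubert.fSum n u v (i - 1)) (DoubleSchubert.fSum n u v i)} : ℤ) := by
  rw [DoubleSchubert.coeff_doubleSchubert]
  congr 3
  ext e
  exact and_congr_right fun he => DoubleSchubert.mem_blockWords_blockVars_iff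
    (he.2.trans hdeg.symm) fun k hk => (he.1.1 k hk).2
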